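/- Let $\mathcal H$ and $\mathcal G$ be real separable Hilbert spaces and let $(\Omega,\mathcal X,\mathbb P)$ be a probability space. Let $A:\mathcal H\rightrightarrows\mathcal H$, $B:\mathcal G\rightrightarrows\mathcal G$ and $D:\mathcal G\rightrightarrows\mathcal G$ be maximally monotone set-valued operators, where $D$ is $\delta$-strongly monotone for some $\delta>0$. Let $C:\mathcal H\to\mathcal H$ be $\mu$-cocoercive for some $\mu>0$ (that is, $C^{-1}$ is $\mu$-strongly monotone), and let $L:\mathcal H\to\mathcal G$ be a bounded linear operator. For every $i\in\{1,\dots,m\}$ let $\alpha_i\in\left]0,1\right[$ and let $T_i:\mathcal H\to\mathcal H$ be $\alpha_i$-averaged nonexpansive, i.e. $\|T_ix-T_iy\|^2\le\|x-y\|^2-\frac{1-\alpha_i}{\alpha_i}\|(x-T_ix)-(y-T_iy)\|^2$ for all $x,y\in\mathcal H$. Set $T_0=\mathrm{Id}$, $S=\bigcap_{i=1}^m\operatorname{Fix}T_i$, let $Z_0$ be the set of all $(x,u)\in\mathcal H\times\mathcal G$ with $0\in Ax+L^*u+Cx$ and $0\in B^{-1}u-Lx+D^{-1}u$, and assume that $Z:=(S\times\mathcal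 G)\cap Z_0\neq\varnothing$. Let $\tau\in\left]0,2\mu\right[$ and $\gamma\in\left]0,2\delta\right[$ satisfy $$\|L\|^2<\Big(\frac1\gamma-\frac1{2\delta}\Big)\Big(\frac1\tau-\frac1{2\mu}\Big).$$ Let $(\epsilon_k)_{k\in\mathbb N}$ be independent random variables with values in $I=\{0,1,\dots,m\}$, set $I_k=\epsilon_k(\Omega)\subset I$ for every $k\in\mathbb N$, let $x^0=\bar x^0\in\mathcal H$ and $u^0\in\mathcal G$, and define, for every $k\in\mathbb N$, $$\begin{aligned}u^{k+1}&=J_{\gamma B^{-1}}\big(u^k+\gamma(L\bar x^k-D^{-1}u^k)\big),\\ p^{k+1}&=J_{\tau A}\big(x^k-\tau(L^*u^{k+1}+Cx^k)\big),\\ x^{k+1}&=T_{\epsilon_{k+1}}p^{k+1},\\ \bar x^{k+1}&=x^{k+1}+p^{k+1}-x^k,\end{aligned}$$ where $J_M=(\mathrm{Id}+M)^{-1}$ denotes the resolvent of $M$. Suppose that one of the following holds: (i) $Z_0\subset S\times\mathcal G$; (ii) there exists an integer $N\ge1$ such that $\{1,\dots,m\}\subset\bigcup_{k=n}^{n+N-1}I_k$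 for every $n\in\mathbb N$, and there exists $\zeta>0$ such that $\mathbb P(\epsilon_k=i)\ge\zeta$ for every $k\in\mathbb N$ and every $i\in I_k\setminus\{0\}$. Then there is a $Z$-valued random variable $z$ such that, $\mathbb P$-almost surely, $((x^k,u^k))_{k\in\mathbb N}$ converges weakly to $z$ in $\mathcal H\times\mathcal G$. -/

import Mathlib

open MeasureTheory ProbabilityTheory Filter Topology
open scoped Pointwise

/-! Set-valued operators `M : H ⇉ H` are represented as maps `H → Set H`. -/

/-- The inverse `M⁻¹ : y ↦ {x | y ∈ M x}` of a set-valued operator. -/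
def opInverse {H : Type*} (M : H → Set H) : H → Set H :=
  fun y => {x | y ∈ M x}

/-- `M` is `ρ`-strongly monotone: `⟪x - y, u - v⟫ ≥ ρ ‖x - y‖²` for all `(x, u)`, `(y, v)` in the
graph of `M`. -/
def IsStronglyMonotoneOp {H : Type*} [NormedAddCommGroup H] [InnerProductSpace ℝ H]
    (ρ : ℝ) (M : H → Set H) : Prop :=
  ∀ x u y v : H, u ∈ M x → v ∈ M y → ρ * ‖x - y‖ ^ 2 ≤ inner ℝ (x - y) (u - v)

/-- `M` is monotone: it is `0`-strongly monotone. -/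
def IsMonotoneOp {H : Type*} [NormedAddCommGroup H] [InnerProductSpace ℝ H]
    (M : H → Set H) : Prop :=
  IsStronglyMonotoneOp 0 M

/-- `M` is maximally monotone: it is maximal among the monotone operators for the pointwise
inclusion order on `H → Set H`, which is the inclusion of graphs. -/
def IsMaximallyMonotoneOp {H : Type*} [NormedAddCommGroup H] [InnerProductSpace ℝ H]
    (M : H → Set H) : Prop :=
  Maximal IsMonotoneOp M

/-- `M` is `ρ`-cocoercive: its inverse is `ρ`-strongly monotone. -/
def IsCocoerciveOp {H : Type*} [NormedAddCommGroup H] [InnerProductSpace ℝ H]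
    (ρ : ℝ) (M : H → Set H) : Prop :=
  IsStronglyMonotoneOp ρ (opInverse M)

/-- The resolvent `J_M = (Id + M)⁻¹`, as a set-valued operator. -/
def resolventOp {H : Type*} [AddCommGroup H] (M : H → Set H) : H → Set H :=
  opInverse (fun x => {x} + M x)

/-- `T` is `α`-averaged nonexpansive (used for `0 < α < 1`). -/
def IsAveragedNonexpansive {H : Type*} [NormedAddCommGroup H] (α : ℝ) (T : H → H) : Prop :=
  ∀ x y : H, ‖T x - T y‖ ^ 2 ≤
    ‖x - y‖ ^ 2 - (1 - α) / α * ‖(x - T x) - (y - T y)‖ ^ 2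

/-- The common fixed point set `S = ⋂ i, Fix (T i)`. -/
def commonFixedPoints {H : Type*} {m : ℕ} (T : Fin m → H → H) : Set H :=
  ⋂ i, Function.fixedPoints (T i)

/-- The set `Z₀` of primal-dual solutions: the pairs `(x, u)` with `0 ∈ A x + L* u + C x` and
`0 ∈ B⁻¹ u - L x + D⁻¹ u`. -/
def primalDualSolutions {H G : Type*}
    [NormedAddCommGroup H] [InnerProductSpace ℝ H] [CompleteSpace H]
    [NormedAddCommGroup G] [InnerProductSpace ℝ G] [CompleteSpace G]
    (A : H → Set H) (B D : G → Set G) (C : H → H) (L : H →L[ℝ] G) : Set (H × G) :=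
  {z | (0 : H) ∈ A z.1 + {ContinuousLinearMap.adjoint L z.2} + {C z.1} ∧
    (0 : G) ∈ opInverse B z.2 - {L z.1} + opInverse D z.2}

/-- The operators `Id, T₁, …, T_m`, indexed by `{0, 1, …, m}`; the index `0` gives `Id`, and the
`i`-th of the `m` operators has index `i + 1` because `Fin m` starts at `0`. -/
def activationOp {H : Type*} {m : ℕ} (T : Fin m → H → H) : Fin (m + 1) → H → H :=
  Fin.cons (α := fun _ => H → H) id T

/-- The sequences `x`, `xbar`, `p`, `u` are generated by the primal-dual routine with activation
indices `e` from `(x₀, x₀, u₀)`. For the operators considered, the resolvents and `D⁻¹` are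
single-valued, so that `q ∈ J y` means `q = J y` and `d` is the value `D⁻¹ uᵏ`.
The value `p 0` plays no role. -/
structure IsPrimalDualIteration {H G : Type*}
    [NormedAddCommGroup H] [InnerProductSpace ℝ H] [CompleteSpace H]
    [NormedAddCommGroup G] [InnerProductSpace ℝ G] [CompleteSpace G]
    (A : H → Set H) (B D : G → Set G) (C : H → H) (L : H →L[ℝ] G)
    {m : ℕ} (T : Fin m → H → H) (τ γ : ℝ) (x₀ : H) (u₀ : G) (e : ℕ → Fin (m + 1))
    (x xbar p : ℕ → H) (u : ℕ → G) : Prop where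
  x_zero : x 0 = x₀
  xbar_zero : xbar 0 = x₀
  u_zero : u 0 = u₀
  u_succ : ∀ k, ∃ d ∈ opInverse D (u k),
    u (k + 1) ∈ resolventOp (fun v => γ • opInverse B v) (u k + γ • (L (xbar k) - d))
  p_succ : ∀ k, p (k + 1) ∈ resolventOp (fun y => τ • A y)
    (x k - τ • (ContinuousLinearMap.adjoint L (u (k + 1)) + C (x k)))
  x_succ : ∀ k, x (k + 1) = activationOp T (e (k + 1)) (p (k + 1))
  xbar_succ : ∀ k, xbar (k + 1) = x (k + 1) + p (k + 1) - x k

/-! Fix a point `(xs, us)` of `Z`. Along every path, the distance γ⁻¹‖u - us‖² + τ⁻¹‖x - xs‖²,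
corrected by a cross term and a square in the extrapolation `r = xbar - x`, is a Lyapunov function.
Monotonicity of `A` and `B`, cocoercivity of `C` and `D⁻¹`, and averagedness of the `T i` make it
decrease by a multiple of a sum of squared residuals (`exists_energy_decrease`). The strict
step-size condition provides the slack. The constants do not depend on the activation indices, so
the residual sums are bounded uniformly in `ω` (`exists_primalDual_bounds`).

Vanishing residuals put every weak cluster point in `Z₀`
(`mem_primalDualSolutions_of_weaklyTendsto`), and Opial's argument yields weak convergence once
cluster points are also known to lie in `S`. Under (i) this is immediate.

Under (ii), `p (k + 1)` depends only on the indices up to `k`, hence is independent of `ε (k + 1)`.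
Integrating the uniform bound on the sums of ‖x (k + 1) - p (k + 1)‖² then bounds the expected sum
of ‖T i p - p‖² over the times when `i` can be drawn (`ae_tendsto_map_sub_self_of_activation`). Such
times meet every window of length `N` and `p` varies slowly, so the whole residual sequence vanishes
almost surely, and demiclosedness gives fixed points. -/

open scoped RealInnerProductSpace

/-! ### Monotone operators, resolvents and cocoercivity -/

section Operators

variable {H G : Type*} [NormedAddCommGroup H] [InnerProductSpace ℝ H]
  [NormedAddCommGroup G] [InnerProductSpace ℝ G]

theorem IsMonotoneOp.inner_nonneg {M : H → Set H} (hM : IsMonotoneOp M) {x v y w : H}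
    (hv : v ∈ M x) (hw : w ∈ M y) : 0 ≤ ⟪x - y, v - w⟫ := by
  simpa using hM x v y w hv hw

/-- Adjoining the single pair `(x, v)` to the graph keeps the operator monotone, so maximality
forces the pair to be there already. -/
theorem IsMaximallyMonotoneOp.mem_of_forall_inner_nonneg {M : H → Set H}
    (hM : IsMaximallyMonotoneOp M) {x v : H}
    (h : ∀ y w, w ∈ M y → 0 ≤ ⟪x - y, v - w⟫) : v ∈ M x := by
  have hmono : IsMonotoneOp (fun y => M y ∪ {v' | y = x ∧ v' = v}) := by
    intro y w y' w' hw hw'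
    rw [zero_mul]
    rcases hw with hw | ⟨rfl, rfl⟩ <;> rcases hw' with hw' | ⟨rfl, rfl⟩
    · exact hM.prop.inner_nonneg hw hw'
    · have := h _ _ hw
      rwa [← neg_sub y, ← neg_sub w, inner_neg_neg] at this
    · exact h _ _ hw'
    · simp
  exact hM.le_of_ge hmono (fun y w hw => Or.inl hw) x (Or.inr ⟨rfl, rfl⟩)

/-- Maximality of the product of a maximally monotone operator and the inverse of another one. -/
theorem IsMaximallyMonotoneOp.mem_and_mem_of_forall_inner_nonneg {A : H → Set H} {B : G → Set G}
    (hA : IsMaximallyMonotoneOp A) (hB : IsMaximallyMonotoneOp B) {x x' : H} {u u' : G}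
    (h : ∀ y w v r, w ∈ A y → v ∈ B r → 0 ≤ ⟪x - y, x' - w⟫ + ⟪u - v, u' - r⟫) :
    x' ∈ A x ∧ u ∈ B u' := by
  have hx : x' ∈ A x := by
    by_contra hx
    have : ¬ ∀ y w, w ∈ A y → 0 ≤ ⟪x - y, x' - w⟫ :=
      fun h' => hx (hA.mem_of_forall_inner_nonneg h')
    push Not at this
    obtain ⟨y, w, hw, hneg⟩ := this
    -- The pair `(y, w)` makes the first summand negative, so the second is positive for every pair
    -- in the graph of `B`. Then `(u', u)` is itself in that graph, and testing with it makes the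
    -- second summand zero.
    have hu : u ∈ B u' := hB.mem_of_forall_inner_nonneg fun r v hv => by
      rw [real_inner_comm]
      linarith [h y w v r hw hv]
    have := h y w u u' hw hu
    simp only [sub_self, inner_zero_left, add_zero] at this
    linarith
  refine ⟨hx, hB.mem_of_forall_inner_nonneg fun r v hv => ?_⟩
  have := h x x' v r hx hv
  rw [real_inner_comm]
  simpa using this

theorem mem_resolventOp {H : Type*} [AddCommGroup H] {M : H → Set H} {q y : H} :
    q ∈ resolventOp M y ↔ y - q ∈ M q := by
  simp only [resolventOp, opInverse, Set.mem_ofPred_eq, Set.singleton_add, Set.mem_image]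
  constructor
  · rintro ⟨w, hw, rfl⟩
    simpa using hw
  · intro h
    exact ⟨_, h, by abel⟩

theorem IsStronglyMonotoneOp.mul_sq_le_of_mem_opInverse {ρ : ℝ} {M : H → Set H}
    (hM : IsStronglyMonotoneOp ρ M) {u d v e : H} (hd : d ∈ opInverse M u)
    (he : e ∈ opInverse M v) : ρ * ‖d - e‖ ^ 2 ≤ ⟪u - v, d - e⟫ := by
  rw [real_inner_comm]
  exact hM _ _ _ _ hd he

theorem IsStronglyMonotoneOp.eq_of_mem_opInverse {ρ : ℝ} (hρ : 0 < ρ) {M : H → Set H}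
    (hM : IsStronglyMonotoneOp ρ M) {u d e : H} (hd : d ∈ opInverse M u)
    (he : e ∈ opInverse M u) : d = e := by
  have := hM.mul_sq_le_of_mem_opInverse hd he
  simp only [sub_self, inner_zero_left] at this
  have h0 : ‖d - e‖ ^ 2 = 0 := le_antisymm (by nlinarith) (sq_nonneg _)
  simpa [sub_eq_zero] using h0

theorem IsMonotoneOp.eq_of_mem_resolventOp {t : ℝ} (ht : 0 < t) {M : H → Set H}
    (hM : IsMonotoneOp M) {y q q' : H} (hq : q ∈ resolventOp (fun v => t • M v) y)
    (hq' : q' ∈ resolventOp (fun v => t • M v) y) : q = q' := by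
  rw [mem_resolventOp] at hq hq'
  obtain ⟨w, hw, hwq⟩ := hq
  obtain ⟨w', hw', hwq'⟩ := hq'
  have h1 := hM.inner_nonneg hw hw'
  have h2 : t • (w - w') = -(q - q') := by
    simp only at hwq hwq'
    rw [smul_sub, hwq, hwq']; abel
  have h3 : t * ⟪q - q', w - w'⟫ = -‖q - q'‖ ^ 2 := by
    rw [← real_inner_smul_right, h2, inner_neg_right, real_inner_self_eq_norm_sq]
  have h0 : ‖q - q'‖ ^ 2 = 0 := le_antisymm (by nlinarith [mul_nonneg ht.le h1]) (sq_nonneg _)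
  simpa [sub_eq_zero] using h0

theorem IsMonotoneOp.opInverse {M : H → Set H} (hM : IsMonotoneOp M) :
    IsMonotoneOp (opInverse M) := by
  intro x u y v hu hv
  rw [real_inner_comm, zero_mul]
  exact hM.inner_nonneg hu hv

theorem IsCocoerciveOp.mul_sq_le {ρ : ℝ} {C : H → H} (hC : IsCocoerciveOp ρ fun x => {C x})
    (x y : H) : ρ * ‖C x - C y‖ ^ 2 ≤ ⟪x - y, C x - C y⟫ :=
  IsStronglyMonotoneOp.mul_sq_le_of_mem_opInverse hC (u := x) (v := y) rfl rfl

theorem mem_of_mem_smul_set {t : ℝ} (ht : 0 < t) {s : Set H} {w : H} (h : w ∈ t • s) :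
    t⁻¹ • w ∈ s := (Set.mem_smul_set_iff_inv_smul_mem₀ ht.ne' s w).1 h

end Operators

/-! ### Averaged operators -/

section Averaged

variable {H : Type*} [NormedAddCommGroup H]

theorem IsAveragedNonexpansive.norm_sub_le {α : ℝ} (hα : 0 < α ∧ α < 1) {T : H → H}
    (hT : IsAveragedNonexpansive α T) (x y : H) : ‖T x - T y‖ ≤ ‖x - y‖ := by
  have h := hT x y
  have h1 : 0 ≤ (1 - α) / α * ‖(x - T x) - (y - T y)‖ ^ 2 :=
    mul_nonneg (div_nonneg (by linarith) hα.1.le) (sq_nonneg _)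
  exact le_of_sq_le_sq (by linarith) (norm_nonneg _)

theorem exists_activationOp_norm_sq_le {m : ℕ} {T : Fin m → H → H} {α : Fin m → ℝ}
    (hα : ∀ i, 0 < α i ∧ α i < 1) (hT : ∀ i, IsAveragedNonexpansive (α i) (T i)) :
    ∃ κ : ℝ, 0 < κ ∧ ∀ j, ∀ z ∈ commonFixedPoints T, ∀ q : H,
      ‖activationOp T j q - z‖ ^ 2 + κ * ‖activationOp T j q - q‖ ^ 2 ≤ ‖q - z‖ ^ 2 := by
  -- `κ` is the smallest averagedness constant. The identity has zero residual, so any positive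
  -- value serves for index `0`; it is given `1`.
  obtain ⟨j₀, hj₀⟩ := Finite.exists_min
    (Fin.cons (α := fun _ => ℝ) 1 (fun i => (1 - α i) / α i) : Fin (m + 1) → ℝ)
  refine ⟨(Fin.cons (α := fun _ => ℝ) 1 (fun i => (1 - α i) / α i) : Fin (m + 1) → ℝ) j₀, ?_,
    fun j z hz q => ?_⟩
  rotate_left
  · refine le_trans (add_le_add_right (mul_le_mul_of_nonneg_right (hj₀ j) (sq_nonneg _)) _) ?_
    cases j using Fin.cases with
    | zero => simp [activationOp]
    | succ i =>
      have hfix : T i z = z := Set.mem_iInter.1 hz i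
      have := hT i q z
      rw [hfix, sub_self, sub_zero] at this
      simp only [activationOp, Fin.cons_succ]
      rw [norm_sub_rev (T i q) q]
      linarith
  · cases j₀ using Fin.cases with
    | zero => simp
    | succ i => simpa using div_pos (by linarith [(hα i).2]) (hα i).1

end Averaged

/-! ### The Lyapunov function and its one-step decrease -/

section Lyapunov

variable {H G : Type*} [NormedAddCommGroup H] [InnerProductSpace ℝ H]
  [NormedAddCommGroup G] [InnerProductSpace ℝ G]

/-- The Lyapunov function of the primal-dual iteration. -/
noncomputable def primalDualEnergy (L : H →L[ℝ] G) (τ γ b : ℝ) (x r : H) (u : G) : ℝ :=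
  γ⁻¹ * ‖u‖ ^ 2 + τ⁻¹ * ‖x‖ ^ 2 + 2 * ⟪u, L r⟫ + b * ‖r‖ ^ 2

theorem two_mul_inner_le_of_norm_sq_le (L : H →L[ℝ] G) {a b : ℝ} (ha : 0 < a)
    (hab : ‖L‖ ^ 2 ≤ a * b) (u : G) (r : H) :
    2 * |⟪u, L r⟫| ≤ a * ‖u‖ ^ 2 + b * ‖r‖ ^ 2 := by
  have h1 : |⟪u, L r⟫| ≤ ‖u‖ * (‖L‖ * ‖r‖) :=
    (abs_real_inner_le_norm _ _).trans (by gcongr; exact L.le_opNorm r)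
  have h2 : ‖L‖ ^ 2 * ‖r‖ ^ 2 ≤ a * b * ‖r‖ ^ 2 := by gcongr
  have h3 : 0 ≤ a * (a * ‖u‖ ^ 2 + b * ‖r‖ ^ 2 - 2 * (‖u‖ * (‖L‖ * ‖r‖))) := by
    nlinarith [sq_nonneg (a * ‖u‖ - ‖L‖ * ‖r‖)]
  have h4 := nonneg_of_mul_nonneg_right h3 ha
  linarith

/-- A forward step evaluates the cocoercive map at the old point, while the monotonicity inequality
tests it at the new one. Young's inequality with weight `q` absorbs the displacement `e` at the cost
of part of the cocoercivity. -/
theorem inner_le_of_mul_sq_le {ρ q : ℝ} (hq : 0 < q) {a d e : H}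
    (h : ρ * ‖d‖ ^ 2 ≤ ⟪a, d⟫) :
    -(2 * ⟪a + e, d⟫) ≤ q * ‖e‖ ^ 2 - (2 * ρ - q⁻¹) * ‖d‖ ^ 2 := by
  have h1 : 0 ≤ q * ‖e + q⁻¹ • d‖ ^ 2 := by positivity
  rw [norm_add_sq_real, norm_smul, real_inner_smul_right, mul_pow, Real.norm_eq_abs, sq_abs,
    inv_pow] at h1
  rw [inner_add_left]
  have h2 : q * (‖e‖ ^ 2 + 2 * (q⁻¹ * ⟪e, d⟫) + (q ^ 2)⁻¹ * ‖d‖ ^ 2) =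
    q * ‖e‖ ^ 2 + 2 * ⟪e, d⟫ + q⁻¹ * ‖d‖ ^ 2 := by field_simp
  linarith


/-- Splitting of the strict step-size condition. -/
theorem exists_splitting_of_lt_mul {l a b : ℝ} (hl : 0 ≤ l) (hb : 0 < b)
    (h : l < a * b) :
    ∃ a₁ a₂ b₁ b₂, 0 < a₁ ∧ a₁ < a₂ ∧ a₂ < a ∧ 0 < b₁ ∧ b₁ < b₂ ∧ b₂ < b ∧ l ≤ a₁ * b₁ := by
  obtain ⟨a₁, h1, h2⟩ := exists_between ((div_lt_iff₀ hb).2 h)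
  have ha₁ : 0 < a₁ := (div_nonneg hl hb.le).trans_lt h1
  have h1' : l / a₁ < b := by
    rw [div_lt_iff₀ hb] at h1
    rw [div_lt_iff₀ ha₁]; linarith
  obtain ⟨a₂, h3, h4⟩ := exists_between h2
  obtain ⟨b₁, h5, h6⟩ := exists_between h1'
  obtain ⟨b₂, h7, h8⟩ := exists_between h6
  refine ⟨a₁, a₂, b₁, b₂, ha₁, h3, h4, (div_nonneg hl ha₁.le).trans_lt h5, h7, h8, ?_⟩
  rw [div_lt_iff₀ ha₁] at h5
  linarith

/-- If `a < 1 / t - 1 / (2 ρ)`, then the cocoercivity constant `ρ` leaves some slack. -/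
theorem two_mul_sub_inv_pos {t ρ a : ℝ} (hρ : 0 < ρ) (h : a < 1 / t - 1 / (2 * ρ)) :
    0 < t⁻¹ - a ∧ 0 < 2 * ρ - (t⁻¹ - a)⁻¹ := by
  have h1 : (2 * ρ)⁻¹ < t⁻¹ - a := by
    rw [one_div, one_div] at h; linarith
  have h2 : 0 < (2 * ρ)⁻¹ := by positivity
  refine ⟨h2.trans h1, ?_⟩
  have := (inv_lt_comm₀ (by positivity) (h2.trans h1)).1 h1
  linarith

theorem two_mul_inner_sub_sub (a b c : H) :
    2 * ⟪b - c, a - b⟫ = ‖a - c‖ ^ 2 - ‖b - c‖ ^ 2 - ‖a - b‖ ^ 2 := by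
  have : a - c = (b - c) + (a - b) := by abel
  rw [this, norm_add_sq_real]; ring

/-- In twice the sum of the two monotonicity inequalities the skew terms ⟪u' - us, L (p - xs)⟫
cancel. The remaining cross terms telescope, with `p - x` as the next `r`, up to ⟪u' - u, L r⟫,
which `a₁` and `b₁` absorb. Young's inequality for `C` and `D⁻¹` uses the weights `τ⁻¹ - b₂` and
`γ⁻¹ - a₂`, so of the squared displacements there remain exactly `b₂ ‖p - x‖²`, part of the new
energy, and the gap `a₂ - a₁`. -/
theorem primalDualEnergy_step [CompleteSpace H] [CompleteSpace G]
    {A : H → Set H} {B D : G → Set G} {C : H → H} {L : H →L[ℝ] G} {δ μ τ γ : ℝ}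
    (hA : IsMonotoneOp A) (hB : IsMonotoneOp B)
    (hDδ : IsStronglyMonotoneOp δ D) (hC : IsCocoerciveOp μ (fun x => {C x}))
    {a₁ a₂ b₁ b₂ : ℝ} (ha₁ : 0 < a₁) (ha₂ : 0 < γ⁻¹ - a₂) (hb₂ : 0 < τ⁻¹ - b₂)
    (hab : ‖L‖ ^ 2 ≤ a₁ * b₁)
    {xs : H} {us ds : G} (hxA : -ContinuousLinearMap.adjoint L us - C xs ∈ A xs)
    (huB : us ∈ B (L xs - ds)) (hds : us ∈ D ds)
    {x p r : H} {u u' d : G} (hd : u ∈ D d)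
    (hu' : u' ∈ B (γ⁻¹ • (u - u') + L (x + r) - d))
    (hp : τ⁻¹ • (x - p) - ContinuousLinearMap.adjoint L u' - C x ∈ A p) :
    primalDualEnergy L τ γ b₂ (p - xs) (p - x) (u' - us) +
      ((a₂ - a₁) * ‖u' - u‖ ^ 2 + (b₂ - b₁) * ‖r‖ ^ 2
        + (2 * μ - (τ⁻¹ - b₂)⁻¹) * ‖C x - C xs‖ ^ 2
        + (2 * δ - (γ⁻¹ - a₂)⁻¹) * ‖d - ds‖ ^ 2) ≤
      primalDualEnergy L τ γ b₂ (x - xs) r (u - us) := by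
  have h1 := hA.inner_nonneg hp hxA
  have h2 : 0 ≤ ⟪u' - us, γ⁻¹ • (u - u') + L (x + r) - d - (L xs - ds)⟫ := by
    rw [real_inner_comm]
    exact hB.inner_nonneg hu' huB
  have h3 := inner_le_of_mul_sq_le hb₂ (e := p - x) (hC.mul_sq_le x xs)
  have h4 := inner_le_of_mul_sq_le ha₂ (e := u' - u)
    (hDδ.mul_sq_le_of_mem_opInverse (u := u) (v := us) hd hds)
  have h5 := two_mul_inner_le_of_norm_sq_le L ha₁ hab (u' - u) r
  have h6 := neg_abs_le ⟪u' - u, L r⟫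
  have h6' := le_abs_self ⟪u' - u, L r⟫
  have e1 : τ⁻¹ • (x - p) - ContinuousLinearMap.adjoint L u' - C x
      - (-ContinuousLinearMap.adjoint L us - C xs) =
      τ⁻¹ • (x - p) - ContinuousLinearMap.adjoint L (u' - us) - (C x - C xs) := by
    rw [map_sub]; abel
  have e2 : γ⁻¹ • (u - u') + L (x + r) - d - (L xs - ds) =
      γ⁻¹ • (u - u') + (L (p - xs) - L (p - x) + L r) - (d - ds) := by
    simp only [map_sub, map_add]; abel
  rw [e1, inner_sub_right, inner_sub_right, real_inner_smul_right,
    ContinuousLinearMap.adjoint_inner_right] at h1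
  rw [e2, inner_sub_right, inner_add_right, real_inner_smul_right, inner_add_right,
    inner_sub_right _ (L (p - xs))] at h2
  have e3 := two_mul_inner_sub_sub x p xs
  have e4 := two_mul_inner_sub_sub u u' us
  have e5 : x - xs + (p - x) = p - xs := by abel
  have e6 : u - us + (u' - u) = u' - us := by abel
  have e7 : ⟪u' - us, L r⟫ = ⟪u - us, L r⟫ + ⟪u' - u, L r⟫ := by rw [← e6, inner_add_left]
  rw [e5] at h3
  rw [e6] at h4
  rw [norm_sub_rev p x] at h3
  rw [norm_sub_rev u' u] at h4 h5 ⊢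
  have e8 : ⟪p - xs, x - p⟫ = (‖x - xs‖ ^ 2 - ‖p - xs‖ ^ 2 - ‖x - p‖ ^ 2) / 2 := by linarith
  have e9 : ⟪u' - us, u - u'⟫ = (‖u - us‖ ^ 2 - ‖u' - us‖ ^ 2 - ‖u - u'‖ ^ 2) / 2 := by linarith
  rw [e8] at h1
  rw [e9] at h2
  have e10 : ⟪L (p - xs), u' - us⟫ = ⟪u' - us, L (p - xs)⟫ := real_inner_comm _ _
  simp only [primalDualEnergy]
  rw [norm_sub_rev p x]
  linarith

end Lyapunov

/-! ### Graph form of the iteration -/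

section Iteration

variable {H G : Type*} [NormedAddCommGroup H] [InnerProductSpace ℝ H] [CompleteSpace H]
  [NormedAddCommGroup G] [InnerProductSpace ℝ G] [CompleteSpace G]

/-- One step of the primal-dual iteration in terms of graph inclusions. -/
theorem IsPrimalDualIteration.exists_dual_seq {A : H → Set H} {B D : G → Set G} {C : H → H}
    {L : H →L[ℝ] G} {m : ℕ} {T : Fin m → H → H} {τ γ : ℝ} {x₀ : H} {u₀ : G}
    {e : ℕ → Fin (m + 1)} {x xbar p : ℕ → H} {u : ℕ → G} (hτ : 0 < τ) (hγ : 0 < γ)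
    (h : IsPrimalDualIteration A B D C L T τ γ x₀ u₀ e x xbar p u) :
    ∃ d : ℕ → G, ∀ k, u k ∈ D (d k) ∧
      u (k + 1) ∈ B (γ⁻¹ • (u k - u (k + 1)) + L (xbar k) - d k) ∧
      τ⁻¹ • (x k - p (k + 1)) - ContinuousLinearMap.adjoint L (u (k + 1)) - C (x k)
        ∈ A (p (k + 1)) := by
  choose d hd hu using h.u_succ
  refine ⟨d, fun k => ⟨hd k, ?_, ?_⟩⟩
  · have := mem_of_mem_smul_set hγ (mem_resolventOp.1 (hu k))
    rw [add_sub_right_comm, smul_add, inv_smul_smul₀ hγ.ne', ← add_sub_assoc] at this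
    exact this
  · have := mem_of_mem_smul_set hτ (mem_resolventOp.1 (h.p_succ k))
    rw [sub_right_comm, smul_sub, inv_smul_smul₀ hτ.ne', ← sub_sub] at this
    exact this

end Iteration

/-! ### Weak convergence, Opial's argument and demiclosedness -/

section WeakConvergence

variable {ι H G : Type*} [NormedAddCommGroup H] [InnerProductSpace ℝ H]
  [NormedAddCommGroup G] [InnerProductSpace ℝ G]

/-- Weak convergence in a Hilbert space, expressed with inner products. -/
def WeaklyTendsto (F : Filter ι) (x : ι → H) (z : H) : Prop :=
  ∀ h : H, Tendsto (fun k => ⟪h, x k⟫) F (𝓝 ⟪h, z⟫)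

namespace WeaklyTendsto

variable {F : Filter ι} {x y : ι → H} {z w : H}

theorem add_tendsto (hx : WeaklyTendsto F x z) (hy : Tendsto y F (𝓝 0)) :
    WeaklyTendsto F (fun k => x k + y k) z := by
  intro h
  have h1 : Tendsto (fun k => ⟪h, y k⟫) F (𝓝 ⟪h, (0 : H)⟫) := tendsto_const_nhds.inner hy
  simpa [inner_add_right] using (hx h).add h1

theorem sub_const (hx : WeaklyTendsto F x z) (c : H) :
    WeaklyTendsto F (fun k => x k - c) (z - c) := by
  intro h
  simpa [inner_sub_right] using (hx h).sub_const ⟪h, c⟫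

theorem inner_tendsto (hx : WeaklyTendsto F x z) {K : ℝ} (hK : ∀ k, ‖x k‖ ≤ K)
    (hy : Tendsto y F (𝓝 w)) : Tendsto (fun k => ⟪x k, y k⟫) F (𝓝 ⟪z, w⟫) := by
  have h1 : Tendsto (fun k => ‖y k - w‖) F (𝓝 0) := tendsto_iff_norm_sub_tendsto_zero.1 hy
  have h2 : Tendsto (fun k => ⟪x k, y k - w⟫) F (𝓝 0) := by
    refine squeeze_zero_norm (a := fun k => K * ‖y k - w‖) (fun k => ?_)
      (by simpa using h1.const_mul K)
    exact (norm_inner_le_norm _ _).trans (by gcongr; exact hK k)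
  have h3 := (hx w).add h2
  rw [add_zero, real_inner_comm] at h3
  refine h3.congr fun k => ?_
  rw [real_inner_comm, ← inner_add_right, add_sub_cancel]

end WeaklyTendsto

/-- Banach–Alaoglu transported through the Riesz isomorphism. Ultrafilters play the role of weakly
convergent subsequences. -/
theorem exists_weaklyTendsto_of_bounded [CompleteSpace H] (F : Ultrafilter ι) {x : ι → H} {K : ℝ}
    (hK : ∀ k, ‖x k‖ ≤ K) : ∃ z, WeaklyTendsto (F : Filter ι) x z := by
  have hc := WeakDual.isCompact_closedBall (𝕜 := ℝ) (E := H) 0 K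
  obtain ⟨φ, -, hφ⟩ := hc.ultrafilter_le_nhds
    (F.map fun k => StrongDual.toWeakDual (InnerProductSpace.toDual ℝ H (x k))) (by
      rw [le_principal_iff]
      refine Filter.Eventually.of_forall (f := (F : Filter ι)) fun k => ?_
      simpa using hK k)
  refine ⟨(InnerProductSpace.toDual ℝ H).symm (WeakDual.toStrongDual φ), fun h => ?_⟩
  have h1 : Tendsto (fun k => StrongDual.toWeakDual (InnerProductSpace.toDual ℝ H (x k)))
      (F : Filter ι) (𝓝 φ) := hφ
  have h2 := ((WeakDual.eval_continuous h).tendsto φ).comp h1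
  rw [real_inner_comm, InnerProductSpace.toDual_symm_apply]
  refine h2.congr fun k => ?_
  rw [real_inner_comm]
  simp

theorem weaklyTendsto_atTop_of_ultrafilter {x : ℕ → H} {z : H}
    (h : ∀ F : Ultrafilter ℕ, (F : Filter ℕ) ≤ atTop → WeaklyTendsto (F : Filter ℕ) x z) :
    WeaklyTendsto atTop x z := by
  intro y
  rw [tendsto_iff_ultrafilter]
  exact fun F hF => h F hF y

/-- Opial's lemma for a weighted norm on a product. -/
theorem exists_weaklyTendsto_of_opial [CompleteSpace H] [CompleteSpace G] {Z : Set (H × G)}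
    {a b : ℝ} (ha : 0 < a) (hb : 0 < b) {x : ℕ → H} {u : ℕ → G} {K : ℝ}
    (hx : ∀ k, ‖x k‖ ≤ K) (hu : ∀ k, ‖u k‖ ≤ K)
    (hconv : ∀ z ∈ Z, ∃ l, Tendsto (fun k => a * ‖u k - z.2‖ ^ 2 + b * ‖x k - z.1‖ ^ 2) atTop (𝓝 l))
    (hlim : ∀ F : Ultrafilter ℕ, (F : Filter ℕ) ≤ atTop → ∀ z : H × G,
      WeaklyTendsto (F : Filter ℕ) x z.1 → WeaklyTendsto (F : Filter ℕ) u z.2 → z ∈ Z) :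
    ∃ z ∈ Z, WeaklyTendsto atTop x z.1 ∧ WeaklyTendsto atTop u z.2 := by
  have hex : ∀ F : Ultrafilter ℕ, ∃ z : H × G,
      WeaklyTendsto (F : Filter ℕ) x z.1 ∧ WeaklyTendsto (F : Filter ℕ) u z.2 := fun F => by
    obtain ⟨z, hz⟩ := exists_weaklyTendsto_of_bounded F hx
    obtain ⟨w, hw⟩ := exists_weaklyTendsto_of_bounded F hu
    exact ⟨(z, w), hz, hw⟩
  choose z hz using hex
  have huniq : ∀ F F' : Ultrafilter ℕ, (F : Filter ℕ) ≤ atTop → (F' : Filter ℕ) ≤ atTop →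
      z F = z F' := by
    intro F F' hF hF'
    obtain ⟨l, hl⟩ := hconv _ (hlim F hF _ (hz F).1 (hz F).2)
    obtain ⟨l', hl'⟩ := hconv _ (hlim F' hF' _ (hz F').1 (hz F').2)
    set v := (z F).2 - (z F').2 with hv
    set y := (z F).1 - (z F').1 with hy
    -- The difference of the two convergent weighted distances is affine in `(x k, u k)`. The
    -- weighted inner product with `(y, v)` therefore converges along `atTop`, so it takes the same
    -- value at both cluster points, which makes their weighted distance zero.
    have hkey : ∀ k, (a * ‖u k - (z F').2‖ ^ 2 + b * ‖x k - (z F').1‖ ^ 2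
        - (a * ‖u k - (z F).2‖ ^ 2 + b * ‖x k - (z F).1‖ ^ 2)
        + (a * (‖(z F).2‖ ^ 2 - ‖(z F').2‖ ^ 2) + b * (‖(z F).1‖ ^ 2 - ‖(z F').1‖ ^ 2))) / 2 =
        a * ⟪v, u k⟫ + b * ⟪y, x k⟫ := by
      intro k
      simp only [norm_sub_sq_real, hv, hy, inner_sub_left]
      rw [real_inner_comm (u k), real_inner_comm (u k), real_inner_comm (x k),
        real_inner_comm (x k)]
      ring
    have hT := (((hl'.sub hl).add_const (a * (‖(z F).2‖ ^ 2 - ‖(z F').2‖ ^ 2)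
      + b * (‖(z F).1‖ ^ 2 - ‖(z F').1‖ ^ 2))).div_const 2).congr hkey
    have h1 := tendsto_nhds_unique (hT.mono_left hF)
      ((((hz F).2 v).const_mul a).add (((hz F).1 y).const_mul b))
    have h2 := tendsto_nhds_unique (hT.mono_left hF')
      ((((hz F').2 v).const_mul a).add (((hz F').1 y).const_mul b))
    have h3 : a * ‖v‖ ^ 2 + b * ‖y‖ ^ 2 = 0 := by
      have e1 : ‖v‖ ^ 2 = ⟪v, (z F).2⟫ - ⟪v, (z F').2⟫ := by
        rw [← inner_sub_right, real_inner_self_eq_norm_sq]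
      have e2 : ‖y‖ ^ 2 = ⟪y, (z F).1⟫ - ⟪y, (z F').1⟫ := by
        rw [← inner_sub_right, real_inner_self_eq_norm_sq]
      rw [e1, e2]
      linarith
    have h4 : 0 ≤ a * ‖v‖ ^ 2 := by positivity
    have h5 : 0 ≤ b * ‖y‖ ^ 2 := by positivity
    have h6 : a * ‖v‖ ^ 2 = 0 := by linarith
    have h7 : b * ‖y‖ ^ 2 = 0 := by linarith
    refine Prod.ext ?_ ?_
    · simpa [hb.ne', hy, sub_eq_zero] using h7
    · simpa [ha.ne', hv, sub_eq_zero] using h6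
  let F₀ : Ultrafilter ℕ := Ultrafilter.of atTop
  have hF₀ : (F₀ : Filter ℕ) ≤ atTop := Ultrafilter.of_le _
  refine ⟨z F₀, hlim F₀ hF₀ _ (hz F₀).1 (hz F₀).2,
    weaklyTendsto_atTop_of_ultrafilter fun F hF => ?_,
    weaklyTendsto_atTop_of_ultrafilter fun F hF => ?_⟩
  · rw [← huniq F F₀ hF hF₀]; exact (hz F).1
  · rw [← huniq F F₀ hF hF₀]; exact (hz F).2

/-- `H × G` carries the sup norm and is not an inner product space here, so a functional is split
into its two components and the Riesz theorem is applied to each. -/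
theorem WeaklyTendsto.tendsto_toWeakSpace [CompleteSpace H] [CompleteSpace G]
    {F : Filter ι} {x : ι → H} {u : ι → G}
    {z : H × G} (hx : WeaklyTendsto F x z.1) (hu : WeaklyTendsto F u z.2) :
    Tendsto (fun k => toWeakSpace ℝ (H × G) (x k, u k)) F (𝓝 (toWeakSpace ℝ (H × G) z)) := by
  refine (WeakBilin.tendsto_iff_forall_eval_tendsto (B := (topDualPairing ℝ (H × G)).flip) ?_).2
    fun f => ?_
  · intro a b hab
    by_contra hne
    obtain ⟨f, hf⟩ := SeparatingDual.exists_separating_of_ne (R := ℝ) hne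
    exact hf (DFunLike.congr_fun hab f)
  · have key : ∀ (y : H) (v : G), f (y, v) =
        ⟪(InnerProductSpace.toDual ℝ H).symm (f.comp (ContinuousLinearMap.inl ℝ H G)), y⟫
        + ⟪(InnerProductSpace.toDual ℝ G).symm (f.comp (ContinuousLinearMap.inr ℝ H G)), v⟫ := by
      intro y v
      rw [InnerProductSpace.toDual_symm_apply, InnerProductSpace.toDual_symm_apply]
      simp [← map_add]
    have h1 := (hx ((InnerProductSpace.toDual ℝ H).symm
      (f.comp (ContinuousLinearMap.inl ℝ H G)))).add (hu ((InnerProductSpace.toDual ℝ G).symm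
      (f.comp (ContinuousLinearMap.inr ℝ H G))))
    rw [← key] at h1
    exact h1.congr fun k => (key _ _).symm

/-- The sum of two maximally monotone operators and a skew coupling is closed under weak
convergence of the points and strong convergence of the residuals. -/
theorem IsMaximallyMonotoneOp.mem_and_mem_of_weaklyTendsto [CompleteSpace H] [CompleteSpace G]
    {A : H → Set H} {B : G → Set G}
    (hA : IsMaximallyMonotoneOp A) (hB : IsMaximallyMonotoneOp B) (L : H →L[ℝ] G)
    {F : Filter ι} [F.NeBot] {x s : ι → H} {u t : ι → G} {x' s' : H} {u' t' : G} {K : ℝ}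
    (hxK : ∀ k, ‖x k‖ ≤ K) (huK : ∀ k, ‖u k‖ ≤ K)
    (hx : WeaklyTendsto F x x') (hu : WeaklyTendsto F u u')
    (hs : Tendsto s F (𝓝 s')) (ht : Tendsto t F (𝓝 t'))
    (hsA : ∀ k, s k - ContinuousLinearMap.adjoint L (u k) ∈ A (x k))
    (htB : ∀ k, u k ∈ B (t k + L (x k))) :
    s' - ContinuousLinearMap.adjoint L u' ∈ A x' ∧ u' ∈ B (t' + L x') := by
  refine hA.mem_and_mem_of_forall_inner_nonneg hB fun y w v r hw hv => ?_
  -- By skewness the bilinear term ⟪L a, c⟫, which is not weakly continuous, cancels. What is left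
  -- only pairs weak with strong limits.
  have key : ∀ (a : H) (b : H) (c d : G),
      ⟪a - y, b - ContinuousLinearMap.adjoint L c - w⟫ + ⟪c - v, d + L a - r⟫ =
      ⟪a - y, b - w⟫ + ⟪c - v, d - r⟫
        + (⟪L y, c⟫ - ⟪ContinuousLinearMap.adjoint L v, a⟫) := by
    intro a b c d
    rw [ContinuousLinearMap.adjoint_inner_left, sub_right_comm b, add_sub_right_comm d,
      inner_sub_right (a - y) (b - w), inner_add_right (c - v) (d - r),
      ContinuousLinearMap.adjoint_inner_right, map_sub, inner_sub_left (L a),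
      inner_sub_left c v (L a), real_inner_comm (L a) c]
    ring
  rw [key]
  have hbx : ∀ k, ‖x k - y‖ ≤ K + ‖y‖ := fun k => (norm_sub_le _ _).trans (by gcongr; exact hxK k)
  have hbu : ∀ k, ‖u k - v‖ ≤ K + ‖v‖ := fun k => (norm_sub_le _ _).trans (by gcongr; exact huK k)
  refine ge_of_tendsto' ((((hx.sub_const y).inner_tendsto hbx (hs.sub_const w)).add
    ((hu.sub_const v).inner_tendsto hbu (ht.sub_const r))).add
    ((hu (L y)).sub (hx (ContinuousLinearMap.adjoint L v)))) fun k => ?_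
  rw [← key]
  have h1 := hA.prop.inner_nonneg (hsA k) hw
  have h2 := hB.prop.inner_nonneg (htB k) hv
  rw [real_inner_comm] at h2
  exact add_nonneg h1 h2

theorem IsMaximallyMonotoneOp.mem_of_weaklyTendsto {M : H → Set H}
    (hM : IsMaximallyMonotoneOp M) {F : Filter ι} [F.NeBot] {x s : ι → H} {x' s' : H} {K : ℝ}
    (hxK : ∀ k, ‖x k‖ ≤ K) (hx : WeaklyTendsto F x x') (hs : Tendsto s F (𝓝 s'))
    (hxM : ∀ k, x k ∈ M (s k)) : x' ∈ M s' := by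
  refine hM.mem_of_forall_inner_nonneg fun y v hv => ?_
  have hbx : ∀ k, ‖x k - v‖ ≤ K + ‖v‖ := fun k => (norm_sub_le _ _).trans (by gcongr; exact hxK k)
  rw [real_inner_comm]
  refine ge_of_tendsto' ((hx.sub_const v).inner_tendsto hbx (hs.sub_const y)) fun k => ?_
  rw [real_inner_comm]
  exact hM.prop.inner_nonneg (hxM k) hv

/-- A cocoercive map is demiclosed. -/
theorem eq_of_weaklyTendsto_of_mul_sq_le {ρ : ℝ} (hρ : 0 < ρ) {C : H → H}
    (hC : ∀ x y, ρ * ‖C x - C y‖ ^ 2 ≤ ⟪x - y, C x - C y⟫)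
    {F : Filter ι} [F.NeBot] {x : ι → H} {x' c : H} {K : ℝ}
    (hxK : ∀ k, ‖x k‖ ≤ K) (hx : WeaklyTendsto F x x')
    (hc : Tendsto (fun k => C (x k)) F (𝓝 c)) : C x' = c := by
  have hbx : ∀ k, ‖x k - x'‖ ≤ K + ‖x'‖ :=
    fun k => (norm_sub_le _ _).trans (by gcongr; exact hxK k)
  have h1 := (hx.sub_const x').inner_tendsto hbx (hc.sub_const (C x'))
  have h2 := ((hc.sub_const (C x')).norm.pow 2).const_mul ρ
  have h3 := le_of_tendsto_of_tendsto' h2 h1 fun k => hC _ _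
  rw [sub_self, inner_zero_left] at h3
  have h4 : ‖c - C x'‖ ^ 2 = 0 := le_antisymm (by nlinarith) (sq_nonneg _)
  have h5 : c - C x' = 0 := by simpa using h4
  exact (sub_eq_zero.1 h5).symm

/-- Browder's demiclosedness principle at `0` for `Id - T`. -/
theorem fixed_of_weaklyTendsto {T : H → H} (hT : ∀ x y, ‖T x - T y‖ ≤ ‖x - y‖)
    {F : Filter ι} [F.NeBot] {x : ι → H} {x' : H} {K : ℝ}
    (hxK : ∀ k, ‖x k‖ ≤ K) (hx : WeaklyTendsto F x x')
    (hc : Tendsto (fun k => x k - T (x k)) F (𝓝 0)) : T x' = x' := by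
  -- `Id - T` is 1/2-cocoercive when `T` is nonexpansive.
  refine (sub_eq_zero.1 (eq_of_weaklyTendsto_of_mul_sq_le (ρ := 1 / 2) (by norm_num)
    (C := fun y => y - T y) (fun y z => ?_) hxK hx hc)).symm
  have h1 : y - T y - (z - T z) = (y - z) - (T y - T z) := by abel
  have h2 : ‖T y - T z‖ ^ 2 ≤ ‖y - z‖ ^ 2 := by gcongr; exact hT y z
  rw [h1, norm_sub_sq_real, inner_sub_right (y - z) (y - z), real_inner_self_eq_norm_sq]
  linarith

end WeakConvergence

/-! ### Energy decrease and uniform bounds along a path -/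

section Asymptotics

variable {H G : Type*} [NormedAddCommGroup H] [InnerProductSpace ℝ H] [CompleteSpace H]
  [NormedAddCommGroup G] [InnerProductSpace ℝ G] [CompleteSpace G]

theorem mem_primalDualSolutions {A : H → Set H} {B D : G → Set G} {C : H → H} {L : H →L[ℝ] G}
    {z : H × G} : z ∈ primalDualSolutions A B D C L ↔
      -ContinuousLinearMap.adjoint L z.2 - C z.1 ∈ A z.1 ∧
        ∃ d, z.2 ∈ B (L z.1 - d) ∧ z.2 ∈ D d := by
  simp only [primalDualSolutions, opInverse, Set.mem_ofPred_eq]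
  refine and_congr ?_ ?_
  · simp only [Set.add_singleton, Set.mem_image]
    constructor
    · rintro ⟨-, ⟨w, hw, rfl⟩, h⟩
      have : w = -ContinuousLinearMap.adjoint L z.2 - C z.1 := by
        rw [← sub_eq_zero, ← h]; abel
      rwa [← this]
    · intro h
      exact ⟨_, ⟨_, h, rfl⟩, by abel⟩
  · simp only [Set.sub_singleton, Set.mem_add, Set.mem_image]
    constructor
    · rintro ⟨-, ⟨w, hw, rfl⟩, d, hd, h⟩
      have : w = L z.1 - d := by
        rw [← sub_eq_zero, ← h]; abel
      exact ⟨d, by rw [← this]; exact hw, hd⟩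
    · rintro ⟨d, h, hd⟩
      exact ⟨_, ⟨_, h, rfl⟩, d, hd, by abel⟩

theorem tendsto_zero_of_norm_sq_le {E : Type*} [NormedAddCommGroup E] {f : ℕ → E} {R : ℕ → ℝ}
    (hR : Tendsto R atTop (𝓝 0)) (h : ∀ k, ‖f k‖ ^ 2 ≤ R k) : Tendsto f atTop (𝓝 0) := by
  rw [tendsto_zero_iff_norm_tendsto_zero]
  have := (squeeze_zero (fun k => sq_nonneg ‖f k‖) h hR).sqrt
  simpa [Real.sqrt_sq (norm_nonneg _)] using this

/-- The residual whose sum is controlled by the energy. -/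
noncomputable def primalDualResidual (C : H → H) (xs : H) (ds : G) (x xbar p : ℕ → H)
    (u d : ℕ → G) (k : ℕ) : ℝ :=
  ‖u (k + 1) - u k‖ ^ 2 + ‖xbar k - x k‖ ^ 2 + ‖x (k + 1) - p (k + 1)‖ ^ 2
    + ‖C (x k) - C xs‖ ^ 2 + ‖d k - ds‖ ^ 2

/-- The energy step goes from `x k` to `p (k + 1)`; applying `T` then brings the point closer to
`xs` and pays for ‖x (k + 1) - p (k + 1)‖². The constants are chosen before the path, which later
allows integration over `ω`. -/
theorem exists_energy_decrease
    {A : H → Set H} {B D : G → Set G} {C : H → H} {L : H →L[ℝ] G} {δ μ : ℝ}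
    (hA : IsMonotoneOp A) (hB : IsMonotoneOp B)
    (hδ : 0 < δ) (hDδ : IsStronglyMonotoneOp δ D)
    (hμ : 0 < μ) (hC : IsCocoerciveOp μ (fun x => {C x}))
    {m : ℕ} {T : Fin m → H → H} {α : Fin m → ℝ}
    (hα : ∀ i, 0 < α i ∧ α i < 1) (hT : ∀ i, IsAveragedNonexpansive (α i) (T i))
    {τ γ : ℝ} (hτ : 0 < τ ∧ τ < 2 * μ) (hγ : 0 < γ ∧ γ < 2 * δ)
    (hL : ‖L‖ ^ 2 < (1 / γ - 1 / (2 * δ)) * (1 / τ - 1 / (2 * μ)))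
    {xs : H} {us ds : G} (hxS : xs ∈ commonFixedPoints T)
    (hxA : -ContinuousLinearMap.adjoint L us - C xs ∈ A xs)
    (huB : us ∈ B (L xs - ds)) (hds : us ∈ D ds) :
    ∃ b c : ℝ, 0 < c ∧ ∀ {x₀ : H} {u₀ : G} {e : ℕ → Fin (m + 1)} {x xbar p : ℕ → H}
      {u d : ℕ → G}, IsPrimalDualIteration A B D C L T τ γ x₀ u₀ e x xbar p u →
      (∀ k, u k ∈ D (d k) ∧
        u (k + 1) ∈ B (γ⁻¹ • (u k - u (k + 1)) + L (xbar k) - d k) ∧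
        τ⁻¹ • (x k - p (k + 1)) - ContinuousLinearMap.adjoint L (u (k + 1)) - C (x k)
          ∈ A (p (k + 1))) →
      ∀ k, primalDualEnergy L τ γ b (x (k + 1) - xs) (xbar (k + 1) - x (k + 1)) (u (k + 1) - us)
          + c * primalDualResidual C xs ds x xbar p u d k
          ≤ primalDualEnergy L τ γ b (x k - xs) (xbar k - x k) (u k - us) ∧
        c * (‖u k - us‖ ^ 2 + ‖x k - xs‖ ^ 2)
          ≤ primalDualEnergy L τ γ b (x k - xs) (xbar k - x k) (u k - us) := by
  have ha : 0 < 1 / γ - 1 / (2 * δ) := sub_pos.2 (one_div_lt_one_div_of_lt hγ.1 hγ.2)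
  have hb : 0 < 1 / τ - 1 / (2 * μ) := sub_pos.2 (one_div_lt_one_div_of_lt hτ.1 hτ.2)
  obtain ⟨a₁, a₂, b₁, b₂, ha₁, ha₁₂, ha₂, hb₁, hb₁₂, hb₂, hab⟩ :=
    exists_splitting_of_lt_mul (sq_nonneg _) hb hL
  obtain ⟨hγ2, hδ2⟩ := two_mul_sub_inv_pos hδ ha₂
  obtain ⟨hτ2, hμ2⟩ := two_mul_sub_inv_pos hμ hb₂
  obtain ⟨κ, hκ, hTκ⟩ := exists_activationOp_norm_sq_le hα hT
  have hτi : 0 < τ⁻¹ := inv_pos.2 hτ.1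
  obtain ⟨c, hc, hc1, hc2, hc3, hc4, hc5, hc6, hc7⟩ : ∃ c, 0 < c ∧ c ≤ a₂ - a₁ ∧ c ≤ b₂ - b₁ ∧
      c ≤ 2 * μ - (τ⁻¹ - b₂)⁻¹ ∧ c ≤ 2 * δ - (γ⁻¹ - a₂)⁻¹ ∧ c ≤ τ⁻¹ * κ ∧ c ≤ γ⁻¹ - a₁ ∧
      c ≤ τ⁻¹ := by
    refine ⟨min (a₂ - a₁) (min (b₂ - b₁) (min (2 * μ - (τ⁻¹ - b₂)⁻¹)
      (min (2 * δ - (γ⁻¹ - a₂)⁻¹) (min (τ⁻¹ * κ) (min (γ⁻¹ - a₁) τ⁻¹))))), ?_, ?_⟩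
    · simp only [lt_min_iff]
      exact ⟨by linarith, by linarith, hμ2, hδ2, by positivity, by linarith, hτi⟩
    · rw [← le_min_iff, ← le_min_iff, ← le_min_iff, ← le_min_iff, ← le_min_iff, ← le_min_iff]
  refine ⟨b₂, c, hc, fun {x₀ u₀ e x xbar p u d} hiter hd k => ⟨?_, ?_⟩⟩
  · have hstep := primalDualEnergy_step (r := xbar k - x k) (x := x k) (u := u k)
      hA hB hDδ hC ha₁ hγ2 hτ2 hab hxA huB hds (hd k).1
      (by simpa using (hd k).2.1) (hd k).2.2
    have hr : xbar (k + 1) - x (k + 1) = p (k + 1) - x k := by rw [hiter.xbar_succ]; abel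
    have hx := mul_le_mul_of_nonneg_left (hTκ (e (k + 1)) xs hxS (p (k + 1))) hτi.le
    rw [← hiter.x_succ] at hx
    rw [hr]
    simp only [primalDualEnergy, primalDualResidual] at hstep ⊢
    have i1 := mul_le_mul_of_nonneg_right hc1 (sq_nonneg ‖u (k + 1) - u k‖)
    have i2 := mul_le_mul_of_nonneg_right hc2 (sq_nonneg ‖xbar k - x k‖)
    have i3 := mul_le_mul_of_nonneg_right hc3 (sq_nonneg ‖C (x k) - C xs‖)
    have i4 := mul_le_mul_of_nonneg_right hc4 (sq_nonneg ‖d k - ds‖)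
    have i5 := mul_le_mul_of_nonneg_right hc5 (sq_nonneg ‖x (k + 1) - p (k + 1)‖)
    linarith
  -- Coercivity: the cross term is absorbed by `a₁ < γ⁻¹` and `b₁ < b₂`.
  · have h5 := two_mul_inner_le_of_norm_sq_le L ha₁ hab (u k - us) (xbar k - x k)
    have h6 := neg_abs_le ⟪u k - us, L (xbar k - x k)⟫
    have i6 := mul_le_mul_of_nonneg_right hc6 (sq_nonneg ‖u k - us‖)
    have i7 := mul_le_mul_of_nonneg_right hc7 (sq_nonneg ‖x k - xs‖)
    have i8 := mul_nonneg (sub_nonneg.2 hb₁₂.le) (sq_nonneg ‖xbar k - x k‖)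
    simp only [primalDualEnergy]
    linarith

/-- Uniform bounds for the primal-dual iteration, with a constant which does not depend on the
activation indices. -/
theorem exists_primalDual_bounds
    {A : H → Set H} {B D : G → Set G} {C : H → H} {L : H →L[ℝ] G} {δ μ : ℝ}
    (hA : IsMonotoneOp A) (hB : IsMonotoneOp B)
    (hδ : 0 < δ) (hDδ : IsStronglyMonotoneOp δ D)
    (hμ : 0 < μ) (hC : IsCocoerciveOp μ (fun x => {C x}))
    {m : ℕ} {T : Fin m → H → H} {α : Fin m → ℝ}
    (hα : ∀ i, 0 < α i ∧ α i < 1) (hT : ∀ i, IsAveragedNonexpansive (α i) (T i))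
    {τ γ : ℝ} (hτ : 0 < τ ∧ τ < 2 * μ) (hγ : 0 < γ ∧ γ < 2 * δ)
    (hL : ‖L‖ ^ 2 < (1 / γ - 1 / (2 * δ)) * (1 / τ - 1 / (2 * μ)))
    {xs : H} {us ds : G} (hxS : xs ∈ commonFixedPoints T)
    (hxA : -ContinuousLinearMap.adjoint L us - C xs ∈ A xs)
    (huB : us ∈ B (L xs - ds)) (hds : us ∈ D ds) (x₀ : H) (u₀ : G) :
    ∃ K : ℝ, ∀ {e : ℕ → Fin (m + 1)} {x xbar p : ℕ → H}
      {u d : ℕ → G}, IsPrimalDualIteration A B D C L T τ γ x₀ u₀ e x xbar p u →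
      (∀ k, u k ∈ D (d k) ∧
        u (k + 1) ∈ B (γ⁻¹ • (u k - u (k + 1)) + L (xbar k) - d k) ∧
        τ⁻¹ • (x k - p (k + 1)) - ContinuousLinearMap.adjoint L (u (k + 1)) - C (x k)
          ∈ A (p (k + 1))) →
      (∀ n, ∑ k ∈ Finset.range n, primalDualResidual C xs ds x xbar p u d k ≤ K) ∧
      (∀ k, ‖u k - us‖ ^ 2 + ‖x k - xs‖ ^ 2 ≤ K) ∧
      ∃ l, Tendsto (fun k => γ⁻¹ * ‖u k - us‖ ^ 2 + τ⁻¹ * ‖x k - xs‖ ^ 2) atTop (𝓝 l) := by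
  obtain ⟨b, c, hc, hdec⟩ := exists_energy_decrease hA hB hδ hDδ hμ hC hα hT hτ hγ hL hxS hxA
    huB hds
  refine ⟨c⁻¹ * primalDualEnergy L τ γ b (x₀ - xs) 0 (u₀ - us),
    fun {e x xbar p u d} hiter hd => ?_⟩
  have h := hdec hiter hd
  set V : ℕ → ℝ := fun k =>
    primalDualEnergy L τ γ b (x k - xs) (xbar k - x k) (u k - us) with hV
  set R : ℕ → ℝ := primalDualResidual C xs ds x xbar p u d with hR
  have hR0 : ∀ k, 0 ≤ R k := fun k => by
    simp only [hR, primalDualResidual]; positivity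
  -- Since `xbar 0 = x 0`, the initial energy is the same for all paths.
  have hV0 : V 0 = primalDualEnergy L τ γ b (x₀ - xs) 0 (u₀ - us) := by
    simp only [hV, hiter.x_zero, hiter.xbar_zero, hiter.u_zero, sub_self]
  have hVnn : ∀ k, 0 ≤ V k := fun k => le_trans (by positivity) (h k).2
  have hanti : Antitone V := antitone_nat_of_succ_le fun k => by
    have := (h k).1
    have := mul_nonneg hc.le (hR0 k)
    simp only [hV]; linarith
  have hsum : ∀ n, V n + c * ∑ k ∈ Finset.range n, R k ≤ V 0 := by
    intro n
    induction n with
    | zero => simp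
    | succ n ih =>
      rw [Finset.sum_range_succ, mul_add]
      have := (h n).1
      simp only [hV] at this ih ⊢
      linarith
  rw [← hV0]
  have hRK : ∀ n, ∑ k ∈ Finset.range n, R k ≤ c⁻¹ * V 0 := fun n => by
    rw [inv_mul_eq_div, le_div_iff₀' hc]
    have := hsum n
    have := hVnn n
    linarith
  have hbd : ∀ k, ‖u k - us‖ ^ 2 + ‖x k - xs‖ ^ 2 ≤ c⁻¹ * V 0 := fun k => by
    rw [inv_mul_eq_div, le_div_iff₀' hc]
    exact (h k).2.trans (hanti (Nat.zero_le k))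
  refine ⟨hRK, hbd, ?_⟩
  have hR1 : Tendsto R atTop (𝓝 0) :=
    (summable_of_sum_range_le hR0 hRK).tendsto_atTop_zero
  have hr : Tendsto (fun k => xbar k - x k) atTop (𝓝 0) := by
    refine tendsto_zero_of_norm_sq_le hR1 fun k => ?_
    simp only [hR, primalDualResidual]
    have := sq_nonneg ‖u (k + 1) - u k‖
    have := sq_nonneg ‖x (k + 1) - p (k + 1)‖
    have := sq_nonneg ‖C (x k) - C xs‖
    have := sq_nonneg ‖d k - ds‖
    linarith
  -- The energy converges, and its terms in `r` vanish because `r → 0` strongly while `u` is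
  -- bounded; this leaves the weighted distance needed for Opial's argument.
  have hVl := tendsto_atTop_ciInf hanti ⟨0, by rintro _ ⟨k, rfl⟩; exact hVnn k⟩
  have hLr : Tendsto (fun k => ⟪u k - us, L (xbar k - x k)⟫) atTop (𝓝 0) := by
    have hLr0 : Tendsto (fun k => L (xbar k - x k)) atTop (𝓝 0) := by
      have := (L.continuous.tendsto 0).comp hr
      rwa [map_zero] at this
    refine squeeze_zero_norm (a := fun k => √(c⁻¹ * V 0) * ‖L (xbar k - x k)‖) (fun k => ?_)
      (by simpa using hLr0.norm.const_mul (√(c⁻¹ * V 0)))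
    refine (norm_inner_le_norm _ _).trans (by
      gcongr
      refine Real.le_sqrt_of_sq_le ?_
      linarith [hbd k, sq_nonneg ‖x k - xs‖])
  refine ⟨_, (((hVl.sub (hLr.const_mul 2)).sub ((hr.norm.pow 2).const_mul b))).congr fun k => ?_⟩
  simp only [hV, primalDualEnergy]
  ring

end Asymptotics

theorem primalDualResidual_tendsto {H G : Type*} [NormedAddCommGroup H]
    [NormedAddCommGroup G] {C : H → H} {xs : H} {ds : G} {x xbar p : ℕ → H}
    {u d : ℕ → G} {K : ℝ}
    (h : ∀ n, ∑ k ∈ Finset.range n, primalDualResidual C xs ds x xbar p u d k ≤ K) :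
    Tendsto (fun k => u (k + 1) - u k) atTop (𝓝 0) ∧
    Tendsto (fun k => xbar k - x k) atTop (𝓝 0) ∧
    Tendsto (fun k => x (k + 1) - p (k + 1)) atTop (𝓝 0) ∧
    Tendsto (fun k => C (x k)) atTop (𝓝 (C xs)) ∧ Tendsto d atTop (𝓝 ds) := by
  have hR0 : ∀ k, 0 ≤ primalDualResidual C xs ds x xbar p u d k := fun k => by
    simp only [primalDualResidual]; positivity
  have hR := (summable_of_sum_range_le hR0 h).tendsto_atTop_zero
  have h1 := fun k => sq_nonneg ‖u (k + 1) - u k‖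
  have h2 := fun k => sq_nonneg ‖xbar k - x k‖
  have h3 := fun k => sq_nonneg ‖x (k + 1) - p (k + 1)‖
  have h4 := fun k => sq_nonneg ‖C (x k) - C xs‖
  have h5 := fun k => sq_nonneg ‖d k - ds‖
  refine ⟨tendsto_zero_of_norm_sq_le hR fun k => ?_,
    tendsto_zero_of_norm_sq_le hR fun k => ?_, tendsto_zero_of_norm_sq_le hR fun k => ?_,
    tendsto_sub_nhds_zero_iff.1 (tendsto_zero_of_norm_sq_le hR fun k => ?_),
    tendsto_sub_nhds_zero_iff.1 (tendsto_zero_of_norm_sq_le hR fun k => ?_)⟩ <;>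
  · simp only [primalDualResidual]
    linarith [h1 k, h2 k, h3 k, h4 k, h5 k]

/-! ### Weak cluster points and pathwise convergence -/

section ClusterPoints

variable {H G : Type*} [NormedAddCommGroup H] [InnerProductSpace ℝ H] [CompleteSpace H]
  [NormedAddCommGroup G] [InnerProductSpace ℝ G] [CompleteSpace G]

theorem mem_primalDualSolutions_of_weaklyTendsto
    {A : H → Set H} {B D : G → Set G} {C : H → H} {L : H →L[ℝ] G} {μ τ γ : ℝ}
    (hA : IsMaximallyMonotoneOp A) (hB : IsMaximallyMonotoneOp B)
    (hD : IsMaximallyMonotoneOp D) (hμ : 0 < μ) (hC : IsCocoerciveOp μ (fun x => {C x}))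
    {x xbar p : ℕ → H} {u d : ℕ → G}
    (hd : ∀ k, u k ∈ D (d k) ∧
        u (k + 1) ∈ B (γ⁻¹ • (u k - u (k + 1)) + L (xbar k) - d k) ∧
        τ⁻¹ • (x k - p (k + 1)) - ContinuousLinearMap.adjoint L (u (k + 1)) - C (x k)
          ∈ A (p (k + 1)))
    {K : ℝ} (hxK : ∀ k, ‖x k‖ ≤ K) (huK : ∀ k, ‖u k‖ ≤ K)
    (hΔ : Tendsto (fun k => u (k + 1) - u k) atTop (𝓝 0))
    (hr : Tendsto (fun k => xbar k - x k) atTop (𝓝 0))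
    (hp : Tendsto (fun k => p (k + 1) - x k) atTop (𝓝 0))
    {c : H} {ds : G} (hCx : Tendsto (fun k => C (x k)) atTop (𝓝 c))
    (hdd : Tendsto d atTop (𝓝 ds)) {F : Filter ℕ} [F.NeBot] (hF : F ≤ atTop) {z : H × G}
    (hx : WeaklyTendsto F x z.1) (hu : WeaklyTendsto F u z.2) :
    z ∈ primalDualSolutions A B D C L := by
  replace hΔ := hΔ.mono_left hF
  replace hr := hr.mono_left hF
  have hpF := hp.mono_left hF
  replace hCx := hCx.mono_left hF
  replace hdd := hdd.mono_left hF
  obtain ⟨M, hM⟩ := hp.norm.bddAbove_range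
  have hpM : ∀ k, ‖p (k + 1) - x k‖ ≤ M := fun k => hM ⟨k, rfl⟩
  have hM0 : 0 ≤ M := (norm_nonneg _).trans (hpM 0)
  have hpK : ∀ k, ‖p (k + 1)‖ ≤ K + M := fun k => by
    calc ‖p (k + 1)‖ = ‖x k + (p (k + 1) - x k)‖ := by rw [add_sub_cancel]
      _ ≤ K + M := (norm_add_le _ _).trans (add_le_add (hxK k) (hpM k))
  have hpw : WeaklyTendsto F (fun k => p (k + 1)) z.1 := by
    simpa using hx.add_tendsto hpF
  have huw : WeaklyTendsto F (fun k => u (k + 1)) z.2 := by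
    simpa using hu.add_tendsto hΔ
  have hCz := eq_of_weaklyTendsto_of_mul_sq_le hμ hC.mul_sq_le hxK hx hCx
  have hDz := hD.mem_of_weaklyTendsto huK hu hdd fun k => (hd k).1
  have hs : Tendsto (fun k => τ⁻¹ • (x k - p (k + 1)) - C (x k)) F (𝓝 (-c)) := by
    have := (hpF.neg.const_smul τ⁻¹).sub hCx
    simpa using this
  -- `L (xbar k)` is split as `L (p (k + 1))` plus a vanishing remainder, so that the skew coupling
  -- is evaluated at the same points as `A` and `B`.
  have ht : Tendsto (fun k => γ⁻¹ • (u k - u (k + 1)) +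
      L ((xbar k - x k) - (p (k + 1) - x k)) - d k) F (𝓝 (-ds)) := by
    have h1 := (L.continuous.tendsto _).comp (hr.sub hpF)
    rw [sub_zero, map_zero] at h1
    have h2 := ((hΔ.neg.const_smul γ⁻¹).add h1).sub hdd
    rw [neg_zero, smul_zero, add_zero, zero_sub] at h2
    refine h2.congr fun k => ?_
    rw [neg_sub]; rfl
  obtain ⟨h1, h2⟩ := hA.mem_and_mem_of_weaklyTendsto hB L hpK
    (fun k => (huK _).trans (by linarith)) hpw huw hs ht
    (fun k => by
      have := (hd k).2.2
      rwa [sub_right_comm] at this)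
    (fun k => by
      convert (hd k).2.1 using 2
      simp only [map_sub]
      abel)
  refine mem_primalDualSolutions.2 ⟨?_, ds, ?_, hDz⟩
  · rwa [hCz, ← neg_add', add_comm, neg_add']
  · rwa [sub_eq_neg_add]

/-- The deterministic core: `hS` isolates the only place where the choice of indices matters. It is
stated for `p` because `p (k + 1)` does not depend on the index `e (k + 1)`. -/
theorem exists_weak_limit_of_fixed_cluster_points
    {A : H → Set H} {B D : G → Set G} {C : H → H} {L : H →L[ℝ] G} {δ μ : ℝ}
    (hA : IsMaximallyMonotoneOp A) (hB : IsMaximallyMonotoneOp B)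
    (hD : IsMaximallyMonotoneOp D)
    (hδ : 0 < δ) (hDδ : IsStronglyMonotoneOp δ D)
    (hμ : 0 < μ) (hC : IsCocoerciveOp μ (fun x => {C x}))
    {m : ℕ} {T : Fin m → H → H} {α : Fin m → ℝ}
    (hα : ∀ i, 0 < α i ∧ α i < 1) (hT : ∀ i, IsAveragedNonexpansive (α i) (T i))
    (hZ : ((commonFixedPoints T ×ˢ Set.univ) ∩ primalDualSolutions A B D C L).Nonempty)
    {τ γ : ℝ} (hτ : 0 < τ ∧ τ < 2 * μ) (hγ : 0 < γ ∧ γ < 2 * δ)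
    (hL : ‖L‖ ^ 2 < (1 / γ - 1 / (2 * δ)) * (1 / τ - 1 / (2 * μ)))
    {x₀ : H} {u₀ : G} {e : ℕ → Fin (m + 1)} {x xbar p : ℕ → H} {u : ℕ → G}
    (hiter : IsPrimalDualIteration A B D C L T τ γ x₀ u₀ e x xbar p u)
    (hS : ∀ {F : Filter ℕ} [F.NeBot] {K : ℝ}, F ≤ atTop → ∀ z ∈ primalDualSolutions A B D C L,
      (∀ k, ‖p (k + 1)‖ ≤ K) → Tendsto (fun k => p (k + 2) - p (k + 1)) atTop (𝓝 0) →
      WeaklyTendsto F (fun k => p (k + 1)) z.1 → z.1 ∈ commonFixedPoints T) :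
    ∃ z ∈ (commonFixedPoints T ×ˢ Set.univ) ∩ primalDualSolutions A B D C L,
      WeaklyTendsto atTop x z.1 ∧ WeaklyTendsto atTop u z.2 := by
  obtain ⟨d, hd⟩ := hiter.exists_dual_seq hτ.1 hγ.1
  obtain ⟨⟨xs, us⟩, ⟨hxS, -⟩, hs⟩ := hZ
  obtain ⟨hxA, ds, huB, hds⟩ := mem_primalDualSolutions.1 hs
  obtain ⟨K, hK⟩ := exists_primalDual_bounds hA.prop hB.prop hδ hDδ hμ hC hα hT hτ hγ hL hxS hxA
    huB hds x₀ u₀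
  obtain ⟨hsum, hbd, -⟩ := hK hiter hd
  obtain ⟨hΔ, hr, hxp, hCx, hdd⟩ := primalDualResidual_tendsto hsum
  have hp : Tendsto (fun k => p (k + 1) - x k) atTop (𝓝 0) := by
    refine ((tendsto_add_atTop_iff_nat 1).2 hr).congr fun k => ?_
    rw [hiter.xbar_succ]; abel
  have hpp : Tendsto (fun k => p (k + 2) - p (k + 1)) atTop (𝓝 0) := by
    have := ((tendsto_add_atTop_iff_nat 1).2 hp).add hxp
    rw [add_zero] at this
    refine this.congr fun k => ?_
    abel
  have hxK : ∀ k, ‖x k‖ ≤ √K + ‖xs‖ + ‖us‖ := fun k => by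
    have h1 : ‖x k - xs‖ ≤ √K := Real.le_sqrt_of_sq_le (by
      have := hbd k; have := sq_nonneg ‖u k - us‖; simp only at *; linarith)
    have h2 := norm_sub_norm_le (x k) xs
    linarith [norm_nonneg us]
  have huK : ∀ k, ‖u k‖ ≤ √K + ‖xs‖ + ‖us‖ := fun k => by
    have h1 : ‖u k - us‖ ≤ √K := Real.le_sqrt_of_sq_le (by
      have := hbd k; have := sq_nonneg ‖x k - xs‖; simp only at *; linarith)
    have h2 := norm_sub_norm_le (u k) us
    linarith [norm_nonneg xs]
  obtain ⟨M, hM⟩ := hp.norm.bddAbove_range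
  have hpK : ∀ k, ‖p (k + 1)‖ ≤ √K + ‖xs‖ + ‖us‖ + M := fun k => by
    calc ‖p (k + 1)‖ = ‖x k + (p (k + 1) - x k)‖ := by rw [add_sub_cancel]
      _ ≤ _ := (norm_add_le _ _).trans (add_le_add (hxK k) (hM ⟨k, rfl⟩))
  refine exists_weaklyTendsto_of_opial (inv_pos.2 hγ.1) (inv_pos.2 hτ.1) hxK huK ?_ ?_
  · rintro ⟨x', u'⟩ ⟨⟨hx'S, -⟩, hz'⟩
    -- Opial's argument needs the distance to every point of `Z` to converge, so the bounds are used
    -- again with the Lyapunov function centred there.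
    obtain ⟨hxA', ds', huB', hds'⟩ := mem_primalDualSolutions.1 hz'
    obtain ⟨K', hK'⟩ := exists_primalDual_bounds hA.prop hB.prop hδ hDδ hμ hC hα hT hτ hγ hL hx'S
      hxA' huB' hds' x₀ u₀
    exact (hK' hiter hd).2.2
  · intro F hF z hx hu
    have hz := mem_primalDualSolutions_of_weaklyTendsto hA hB hD hμ hC hd hxK huK hΔ hr hp hCx hdd
      hF hx hu
    refine ⟨⟨hS hF z hz hpK hpp ?_, trivial⟩, hz⟩
    simpa using hx.add_tendsto (hp.mono_left hF)

/-- If `T a - a` is small along a set of indices meeting every window of length `N`, and `a` is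
slowly varying, then `T a - a` is small. -/
theorem tendsto_map_sub_self_of_window {E : Type*} [NormedAddCommGroup E] {T : E → E}
    (hT : ∀ x y, ‖T x - T y‖ ≤ ‖x - y‖) {a : ℕ → E}
    (ha : Tendsto (fun k => a (k + 1) - a k) atTop (𝓝 0)) {s : Set ℕ} {N : ℕ}
    (hs : ∀ n, ∃ k ∈ Set.Ico n (n + N), k ∈ s)
    (h : Tendsto (s.indicator fun k => ‖T (a k) - a k‖) atTop (𝓝 0)) :
    Tendsto (fun k => T (a k) - a k) atTop (𝓝 0) := by
  set b : ℕ → ℝ := fun k => ‖T (a k) - a k‖ with hb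
  have hstep : ∀ k, b k ≤ b (k + 1) + 2 * ‖a (k + 1) - a k‖ := fun k => by
    have e : T (a k) - a k =
        (T (a (k + 1)) - a (k + 1)) + ((T (a k) - T (a (k + 1))) + (a (k + 1) - a k)) := by abel
    calc b k ≤ b (k + 1) + (‖T (a k) - T (a (k + 1))‖ + ‖a (k + 1) - a k‖) := by
          simp only [hb]; rw [e]
          exact (norm_add_le _ _).trans (by gcongr; exact norm_add_le _ _)
      _ ≤ _ := by
          have := hT (a k) (a (k + 1))
          rw [norm_sub_rev (a k)] at this
          linarith
  have hind : ∀ k, 0 ≤ s.indicator b k := fun k =>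
    Set.indicator_nonneg (fun _ _ => norm_nonneg _) k
  have hsteps : ∀ j n, b n ≤ b (n + j) + ∑ i ∈ Finset.range j, 2 * ‖a (n + i + 1) - a (n + i)‖ := by
    intro j n
    induction j with
    | zero => simp
    | succ j ih =>
      rw [Finset.sum_range_succ]
      have := hstep (n + j)
      rw [← add_assoc n j 1]
      linarith
  -- Moving to the good index of the window costs twice the increments of `a`. Summing over the
  -- whole window removes the dependence on which index is good.
  have hbound : ∀ n, b n ≤ ∑ i ∈ Finset.range N,
      (s.indicator b (n + i) + 2 * ‖a (n + i + 1) - a (n + i)‖) := by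
    intro n
    obtain ⟨k, ⟨hk1, hk2⟩, hks⟩ := hs n
    obtain ⟨j, rfl⟩ := Nat.exists_eq_add_of_le hk1
    have hj : j < N := by omega
    rw [Finset.sum_add_distrib]
    refine (hsteps j n).trans (add_le_add ?_ ?_)
    · rw [← Set.indicator_of_mem hks b]
      exact Finset.single_le_sum (f := fun i => s.indicator b (n + i)) (fun i _ => hind _)
        (Finset.mem_range.2 hj)
    · exact Finset.sum_le_sum_of_subset_of_nonneg
        (Finset.range_subset_range.2 hj.le) fun _ _ _ => by positivity
  have hlim : Tendsto (fun n => ∑ i ∈ Finset.range N,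
      (s.indicator b (n + i) + 2 * ‖a (n + i + 1) - a (n + i)‖)) atTop (𝓝 0) := by
    have : Tendsto (fun k => s.indicator b k + 2 * ‖a (k + 1) - a k‖) atTop (𝓝 0) := by
      simpa using h.add (ha.norm.const_mul 2)
    simpa using tendsto_finsetSum (Finset.range N) fun i _ =>
      (tendsto_add_atTop_iff_nat i).2 this
  rw [tendsto_zero_iff_norm_tendsto_zero]
  exact squeeze_zero (fun _ => norm_nonneg _) hbound hlim

end ClusterPoints

/-! ### Measurability of the weak limit -/

section Measurability

variable {Ω H : Type*} [NormedAddCommGroup H] [InnerProductSpace ℝ H]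

/-- With `s` countable, this writes a closed ball as a countable intersection of half-spaces. -/
theorem norm_le_iff_forall_inner_le_of_dense {s : Set H} (hs : Dense s) {y : H} {r : ℝ}
    (hr : 0 ≤ r) : ‖y‖ ≤ r ↔ ∀ h ∈ s, ⟪h, y⟫ ≤ r * ‖h‖ := by
  constructor
  · intro hy h _
    rw [mul_comm]
    exact (real_inner_le_norm h y).trans (by gcongr)
  · intro h
    have hclosed : IsClosed {z : H | ⟪z, y⟫ ≤ r * ‖z‖} :=
      isClosed_le (by fun_prop) (by fun_prop)
    have hy : ⟪y, y⟫ ≤ r * ‖y‖ := hclosed.closure_subset_iff.2 h (hs y)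
    rcases (norm_nonneg y).eq_or_lt with h0 | h0
    · rwa [← h0]
    · rw [real_inner_self_eq_norm_sq, sq] at hy
      exact le_of_mul_le_mul_right hy h0

/-- A weak form of the Pettis measurability theorem in a separable Hilbert space. -/
theorem measurable_of_forall_inner_measurable [MeasurableSpace Ω]
    [TopologicalSpace.SeparableSpace H] [MeasurableSpace H] [BorelSpace H] {f : Ω → H}
    (hf : ∀ h : H, Measurable fun ω => ⟪h, f ω⟫) : Measurable f := by
  obtain ⟨s, hs, hsd⟩ := TopologicalSpace.exists_countable_dense H
  have : SecondCountableTopology H := UniformSpace.secondCountable_of_separable H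
  have hdist : ∀ c : H, Measurable fun ω => dist (f ω) c := by
    intro c
    refine measurable_of_Iic fun r => ?_
    by_cases hr : 0 ≤ r
    · have : (fun ω => dist (f ω) c) ⁻¹' Set.Iic r =
          ⋂ h ∈ s, {ω | ⟪h, f ω⟫ - ⟪h, c⟫ ≤ r * ‖h‖} := by
        ext ω
        simp only [Set.mem_preimage, Set.mem_Iic, Set.mem_iInter, Set.mem_ofPred_eq, dist_eq_norm,
          norm_le_iff_forall_inner_le_of_dense hsd hr, inner_sub_right]
      rw [this]
      exact MeasurableSet.biInter hs fun h _ =>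
        measurableSet_le ((hf h).sub_const _) measurable_const
    · have : (fun ω => dist (f ω) c) ⁻¹' Set.Iic r = ∅ :=
        Set.eq_empty_of_forall_notMem fun ω (hω : dist (f ω) c ≤ r) => hr (dist_nonneg.trans hω)
      rw [this]
      exact MeasurableSet.empty
  have hbasis : TopologicalSpace.IsTopologicalBasis
      {b : Set H | ∃ c r, b = Metric.ball c r} := by
    refine TopologicalSpace.isTopologicalBasis_of_isOpen_of_nhds ?_ fun a u ha hu => ?_
    · rintro _ ⟨c, r, rfl⟩
      exact Metric.isOpen_ball
    · obtain ⟨r, hr, hsub⟩ := Metric.isOpen_iff.1 hu a ha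
      exact ⟨_, ⟨a, r, rfl⟩, Metric.mem_ball_self hr, hsub⟩
  rw [BorelSpace.measurable_eq (α := H), hbasis.borel_eq_generateFrom]
  refine measurable_generateFrom ?_
  rintro _ ⟨c, r, rfl⟩
  exact measurableSet_lt (hdist c) measurable_const

/-- An almost sure weak limit of measurable functions, with values in a set `Z`, has a measurable
version with values in `Z` everywhere. -/
theorem exists_measurable_weak_limit {G : Type*} [NormedAddCommGroup G] [InnerProductSpace ℝ G]
    [MeasurableSpace Ω] {P : Measure Ω}
    [TopologicalSpace.SeparableSpace H] [MeasurableSpace H] [BorelSpace H]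
    [TopologicalSpace.SeparableSpace G] [MeasurableSpace G] [BorelSpace G]
    {Z : Set (H × G)} (hZ : Z.Nonempty) {x : ℕ → Ω → H} {u : ℕ → Ω → G}
    (hx : ∀ k, Measurable (x k)) (hu : ∀ k, Measurable (u k))
    (h : ∀ᵐ ω ∂P, ∃ z ∈ Z, WeaklyTendsto atTop (fun k => x k ω) z.1 ∧
      WeaklyTendsto atTop (fun k => u k ω) z.2) :
    ∃ z : Ω → H × G, Measurable z ∧ (∀ ω, z ω ∈ Z) ∧
      ∀ᵐ ω ∂P, WeaklyTendsto atTop (fun k => x k ω) (z ω).1 ∧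
        WeaklyTendsto atTop (fun k => u k ω) (z ω).2 := by
  classical
  obtain ⟨z₀, hz₀⟩ := hZ
  -- The limit is set to `z₀` on a measurable null set `t` covering the bad paths. Elsewhere the
  -- inner products of the chosen limit are pointwise limits, so the choice is measurable.
  obtain ⟨t, hst, ht, ht0⟩ := exists_measurable_superset_of_null (ae_iff.1 h)
  have hgood : ∀ ω, ∃ z ∈ Z, (ω ∈ t → z = z₀) ∧ (ω ∉ t →
      WeaklyTendsto atTop (fun k => x k ω) z.1 ∧ WeaklyTendsto atTop (fun k => u k ω) z.2) := by
    intro ω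
    by_cases hω : ω ∈ t
    · exact ⟨z₀, hz₀, fun _ => rfl, fun h => absurd hω h⟩
    · obtain ⟨z, hz, hxz⟩ := not_not.1 fun hc => hω (hst hc)
      exact ⟨z, hz, fun h => absurd h hω, fun _ => hxz⟩
  choose z hzZ hz1 hz2 using hgood
  refine ⟨z, Measurable.prodMk (f := fun ω => (z ω).1) (g := fun ω => (z ω).2)
    (measurable_of_forall_inner_measurable fun y => ?_)
    (measurable_of_forall_inner_measurable fun y => ?_), hzZ, ?_⟩
  · refine measurable_of_tendsto_metrizable
      (f := fun k => t.piecewise (fun _ => ⟪y, z₀.1⟫) fun ω => ⟪y, x k ω⟫)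
      (fun k => Measurable.piecewise ht measurable_const ((hx k).const_inner)) ?_
    rw [tendsto_pi_nhds]
    intro ω
    by_cases hω : ω ∈ t
    · simp [Set.piecewise, hω, hz1 ω hω]
    · simpa [Set.piecewise, hω] using (hz2 ω hω).1 y
  · refine measurable_of_tendsto_metrizable
      (f := fun k => t.piecewise (fun _ => ⟪y, z₀.2⟫) fun ω => ⟪y, u k ω⟫)
      (fun k => Measurable.piecewise ht measurable_const ((hu k).const_inner)) ?_
    rw [tendsto_pi_nhds]
    intro ω
    by_cases hω : ω ∈ t
    · simp [Set.piecewise, hω, hz1 ω hω]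
    · simpa [Set.piecewise, hω] using (hz2 ω hω).2 y
  · have : ∀ᵐ ω ∂P, ω ∉ t := measure_eq_zero_iff_ae_notMem.1 ht0
    filter_upwards [this] with ω hω using hz2 ω hω

end Measurability

/-! ### Independence and almost sure vanishing of residuals -/

section Independence

variable {Ω : Type*} [MeasurableSpace Ω] {P : Measure Ω}

/-- If `E k` is independent of `φ k`, has probability bounded below for `k ∈ s`, and the sum of
the `φ k` over the occurring events is bounded, then `φ k → 0` along `s` almost surely. -/
theorem ae_tendsto_indicator_of_indep {φ : ℕ → Ω → ENNReal} (hφ : ∀ k, Measurable (φ k))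
    {E : ℕ → Set Ω} (hE : ∀ k, MeasurableSet (E k)) [IsProbabilityMeasure P]
    (hind : ∀ k, ∫⁻ ω, (E k).indicator (φ k) ω ∂P = P (E k) * ∫⁻ ω, φ k ω ∂P)
    {K : ENNReal} (hK : K ≠ ⊤) (hsum : ∀ ω, ∑' k, (E k).indicator (φ k) ω ≤ K)
    {s : Set ℕ} {ζ : ENNReal} (hζ : ζ ≠ 0) (hs : ∀ k ∈ s, ζ ≤ P (E k)) :
    ∀ᵐ ω ∂P, Tendsto (s.indicator fun k => φ k ω) atTop (𝓝 0) := by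
  classical
  have hle : ∀ k, ζ * ∫⁻ ω, s.indicator (fun k => φ k ω) k ∂P ≤
      ∫⁻ ω, (E k).indicator (φ k) ω ∂P := by
    intro k
    by_cases hk : k ∈ s
    · simp only [Set.indicator_of_mem hk, hind]
      gcongr
      exact hs k hk
    · simp [Set.indicator_of_notMem hk]
  have hmeas : ∀ k, Measurable fun ω => s.indicator (fun k => φ k ω) k := by
    intro k
    by_cases hk : k ∈ s
    · simpa only [Set.indicator_of_mem hk] using hφ k
    · simp [Set.indicator_of_notMem hk]
  -- Independence replaces each event by its probability, at least `ζ` on `s`, so the pathwise bound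
  -- becomes a bound on the expected full sum.
  have h1 : ζ * ∫⁻ ω, ∑' k, s.indicator (fun k => φ k ω) k ∂P ≤ K := by
    rw [lintegral_tsum fun k => (hmeas k).aemeasurable, ← ENNReal.tsum_mul_left]
    calc _ ≤ ∑' k, ∫⁻ ω, (E k).indicator (φ k) ω ∂P := ENNReal.tsum_le_tsum hle
      _ = ∫⁻ ω, ∑' k, (E k).indicator (φ k) ω ∂P :=
        (lintegral_tsum fun k => ((hφ k).indicator (hE k)).aemeasurable).symm
      _ ≤ ∫⁻ _, K ∂P := lintegral_mono hsum
      _ = K := by simp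
  have h2 : ∫⁻ ω, ∑' k, s.indicator (fun k => φ k ω) k ∂P ≠ ⊤ := by
    intro htop
    rw [htop, ENNReal.mul_top hζ] at h1
    exact hK (top_le_iff.1 h1)
  filter_upwards [ae_lt_top (Measurable.tsum hmeas) h2] with ω hω
  exact ENNReal.tendsto_atTop_zero_of_tsum_ne_top hω.ne

theorem lintegral_indicator_of_indepFun {α : Type*} [MeasurableSpace α]
    [MeasurableSingletonClass α] {X : Ω → α} (hX : Measurable X) {φ : Ω → ENNReal}
    (hφ : Measurable φ) (h : IndepFun X φ P) (a : α) :
    ∫⁻ ω, (X ⁻¹' {a}).indicator φ ω ∂P = P (X ⁻¹' {a}) * ∫⁻ ω, φ ω ∂P := by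
  have h1 : Measurable (({a} : Set α).indicator (fun _ => (1 : ENNReal))) :=
    measurable_const.indicator (measurableSet_singleton a)
  have h2 := lintegral_mul_eq_lintegral_mul_lintegral_of_indepFun (h1.comp hX) hφ
    (h.comp h1 measurable_id)
  have h3 : ∫⁻ ω, (({a} : Set α).indicator (fun _ => (1 : ENNReal)) ∘ X) ω ∂P = P (X ⁻¹' {a}) := by
    rw [← lintegral_indicator_one (hX (measurableSet_singleton a))]
    rfl
  rw [h3] at h2
  rw [← h2]
  refine lintegral_congr fun ω => ?_
  by_cases hω : X ω = a <;> simp [Set.indicator, hω]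

/-- A function of finitely many discrete random variables `ε j`, `j ∈ S`, is measurable, and
independent of `ε k` for `k ∉ S`. -/
theorem measurable_and_indepFun_of_factorsThrough {α β : Type*} [Finite α] [MeasurableSpace α]
    [MeasurableSingletonClass α] [MeasurableSpace β] {ε : ℕ → Ω → α}
    (hε : ∀ k, Measurable (ε k)) (hindep : iIndepFun ε P) (S : Finset ℕ)
    [Nonempty β] {f : Ω → β} (hf : ∀ ω ω', (∀ j ∈ S, ε j ω = ε j ω') → f ω = f ω') :
    Measurable f ∧ ∀ k, k ∉ S → IndepFun (ε k) f P := by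
  -- `f` factors through the finite space `S → α`, on which every map is measurable; no
  -- measurability of the operators enters.
  obtain ⟨g, rfl⟩ : ∃ g : (S → α) → β, f = g ∘ fun ω (i : S) => ε i ω :=
    (Function.factorsThrough_iff f).1 fun ω ω' h => hf ω ω' fun j hj => congr_fun h ⟨j, hj⟩
  have hg : Measurable g := measurable_of_finite g
  refine ⟨hg.comp (measurable_pi_lambda _ fun i => hε i), fun k hk => ?_⟩
  have h := hindep.indepFun_finset {k} S (Finset.disjoint_singleton_left.2 hk) hε
  exact h.comp (φ := fun v : (({k} : Finset ℕ) → α) => v ⟨k, Finset.mem_singleton_self k⟩)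
    (measurable_pi_apply _) hg

end Independence

/-! ### Dependence of the iterates on the activation indices -/

section Iterates

variable {H G : Type*} [NormedAddCommGroup H] [InnerProductSpace ℝ H] [CompleteSpace H]
  [NormedAddCommGroup G] [InnerProductSpace ℝ G] [CompleteSpace G]

/-- The iterates up to the computation of `p (k + 1)` only depend on the activation indices up
to `k`. -/
theorem IsPrimalDualIteration.eq_of_eq_le {A : H → Set H} {B D : G → Set G} {C : H → H}
    {L : H →L[ℝ] G} {δ : ℝ} (hA : IsMonotoneOp A) (hB : IsMonotoneOp B) (hδ : 0 < δ)
    (hDδ : IsStronglyMonotoneOp δ D) {m : ℕ} {T : Fin m → H → H} {τ γ : ℝ} (hτ : 0 < τ)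
    (hγ : 0 < γ) {x₀ : H} {u₀ : G} {e e' : ℕ → Fin (m + 1)} {x xbar p x' xbar' p' : ℕ → H}
    {u u' : ℕ → G} (h : IsPrimalDualIteration A B D C L T τ γ x₀ u₀ e x xbar p u)
    (h' : IsPrimalDualIteration A B D C L T τ γ x₀ u₀ e' x' xbar' p' u') (k : ℕ)
    (he : ∀ j ≤ k, e j = e' j) :
    x k = x' k ∧ xbar k = xbar' k ∧ u k = u' k ∧ p (k + 1) = p' (k + 1) := by
  have step : ∀ k, x k = x' k → xbar k = xbar' k → u k = u' k →
      u (k + 1) = u' (k + 1) ∧ p (k + 1) = p' (k + 1) := by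
    intro k hx hxbar hu
    obtain ⟨d, hd, hu1⟩ := h.u_succ k
    obtain ⟨d', hd', hu1'⟩ := h'.u_succ k
    rw [hu] at hd
    obtain rfl := hDδ.eq_of_mem_opInverse hδ hd hd'
    rw [hu, hxbar] at hu1
    have hu2 := hB.opInverse.eq_of_mem_resolventOp hγ hu1 hu1'
    refine ⟨hu2, ?_⟩
    have hp := h.p_succ k
    rw [hx, hu2] at hp
    exact hA.eq_of_mem_resolventOp hτ hp (h'.p_succ k)
  induction k with
  | zero =>
    have hx : x 0 = x' 0 := by rw [h.x_zero, h'.x_zero]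
    have hxb : xbar 0 = xbar' 0 := by rw [h.xbar_zero, h'.xbar_zero]
    have hu : u 0 = u' 0 := by rw [h.u_zero, h'.u_zero]
    exact ⟨hx, hxb, hu, (step 0 hx hxb hu).2⟩
  | succ k ih =>
    obtain ⟨hx, hxb, hu, hp⟩ := ih fun j hj => he j (by omega)
    have hx1 : x (k + 1) = x' (k + 1) := by
      rw [h.x_succ, h'.x_succ, hp, he (k + 1) le_rfl]
    have hxb1 : xbar (k + 1) = xbar' (k + 1) := by
      rw [h.xbar_succ, h'.xbar_succ, hp, hx1, hx]
    have hu1 := (step k hx hxb hu).1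
    exact ⟨hx1, hxb1, hu1, (step (k + 1) hx1 hxb1 hu1).2⟩

end Iterates

/-- Each operator that is activated with probability at least `ζ` along `s` has vanishing residuals
along `s`, almost surely. -/
theorem ae_tendsto_map_sub_self_of_activation {Ω H : Type*} [NormedAddCommGroup H] [MeasurableSpace Ω] (P : Measure Ω)
    [IsProbabilityMeasure P] {m : ℕ} {ε : ℕ → Ω → Fin (m + 1)} (hε : ∀ k, Measurable (ε k))
    (hindep : iIndepFun ε P) {T : Fin m → H → H} {x p : ℕ → Ω → H}
    (hx : ∀ k ω, x (k + 1) ω = activationOp T (ε (k + 1) ω) (p (k + 1) ω))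
    (hp : ∀ k ω ω', (∀ j ≤ k, ε j ω = ε j ω') → p (k + 1) ω = p (k + 1) ω')
    {K : ℝ} (hK : ∀ ω n, ∑ k ∈ Finset.range n, ‖x (k + 1) ω - p (k + 1) ω‖ ^ 2 ≤ K)
    {ζ : ℝ} (hζ : 0 < ζ) (j : Fin (m + 1)) {s : Set ℕ}
    (hs : ∀ k ∈ s, ζ ≤ P.real (ε (k + 1) ⁻¹' {j})) :
    ∀ᵐ ω ∂P, Tendsto (s.indicator fun k => ‖activationOp T j (p (k + 1) ω) - p (k + 1) ω‖)
      atTop (𝓝 0) := by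
  classical
  set φ : ℕ → Ω → ENNReal := fun k ω =>
    ENNReal.ofReal (‖activationOp T j (p (k + 1) ω) - p (k + 1) ω‖ ^ 2) with hφdef
  have hφ : ∀ k, Measurable (φ k) ∧ ∀ i, i ∉ Finset.range (k + 1) → IndepFun (ε i) (φ k) P :=
    fun k => measurable_and_indepFun_of_factorsThrough hε hindep (Finset.range (k + 1))
      fun ω ω' h => by
        simp only [hφdef]
        rw [hp k ω ω' fun i hi => h i (Finset.mem_range.2 (by omega))]
  -- On the event that `j` is drawn, `φ k` is exactly ‖x (k + 1) - p (k + 1)‖².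
  have hsum : ∀ ω, ∑' k, (ε (k + 1) ⁻¹' {j}).indicator (φ k) ω ≤ ENNReal.ofReal K := by
    intro ω
    refine ENNReal.tsum_le_of_sum_range_le fun n => ?_
    calc _ ≤ ∑ k ∈ Finset.range n, ENNReal.ofReal (‖x (k + 1) ω - p (k + 1) ω‖ ^ 2) := by
          refine Finset.sum_le_sum fun k _ => ?_
          refine Set.indicator_le' (f := φ k)
            (g := fun ω => ENNReal.ofReal (‖x (k + 1) ω - p (k + 1) ω‖ ^ 2))
            (fun ω hω => ?_) (fun _ _ => zero_le) ω
          rw [hx, show ε (k + 1) ω = j from hω]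
      _ = ENNReal.ofReal (∑ k ∈ Finset.range n, ‖x (k + 1) ω - p (k + 1) ω‖ ^ 2) :=
          (ENNReal.ofReal_sum_of_nonneg fun _ _ => sq_nonneg _).symm
      _ ≤ _ := ENNReal.ofReal_le_ofReal (hK ω n)
  have key := ae_tendsto_indicator_of_indep (P := P) (fun k => (hφ k).1)
    (E := fun k => ε (k + 1) ⁻¹' {j})
    (fun k => hε (k + 1) (measurableSet_singleton j))
    (fun k => lintegral_indicator_of_indepFun (hε (k + 1)) (hφ k).1
      ((hφ k).2 (k + 1) (by simp)) j)
    ENNReal.ofReal_ne_top hsum (s := s) (ζ := ENNReal.ofReal ζ) (by simpa using hζ)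
    (fun k hk => ENNReal.ofReal_le_of_le_toReal (hs k hk))
  filter_upwards [key] with ω hω
  have h1 := ((ENNReal.tendsto_toReal ENNReal.zero_ne_top).comp hω).sqrt
  simp only [ENNReal.toReal_zero, Real.sqrt_zero] at h1
  refine h1.congr fun k => ?_
  by_cases hk : k ∈ s
  · simp [hk, hφdef]
  · simp [hk]

theorem theorem1
    {H G Ω : Type*}
    [NormedAddCommGroup H] [InnerProductSpace ℝ H] [CompleteSpace H]
    [TopologicalSpace.SeparableSpace H] [MeasurableSpace H] [BorelSpace H]
    [NormedAddCommGroup G] [InnerProductSpace ℝ G] [CompleteSpace G]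
    [TopologicalSpace.SeparableSpace G] [MeasurableSpace G] [BorelSpace G]
    [MeasurableSpace Ω] (P : Measure Ω) [IsProbabilityMeasure P]
    -- the operators
    (A : H → Set H) (B D : G → Set G) (C : H → H) (L : H →L[ℝ] G) (δ μ : ℝ)
    (hA : IsMaximallyMonotoneOp A) (hB : IsMaximallyMonotoneOp B)
    (hD : IsMaximallyMonotoneOp D) (hδ : 0 < δ) (hDδ : IsStronglyMonotoneOp δ D)
    (hμ : 0 < μ) (hC : IsCocoerciveOp μ (fun x => {C x}))
    {m : ℕ} (T : Fin m → H → H) (α : Fin m → ℝ)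
    (hα : ∀ i, 0 < α i ∧ α i < 1) (hT : ∀ i, IsAveragedNonexpansive (α i) (T i))
    (hZ : ((commonFixedPoints T ×ˢ Set.univ) ∩ primalDualSolutions A B D C L).Nonempty)
    -- the step sizes
    (τ γ : ℝ) (hτ : 0 < τ ∧ τ < 2 * μ) (hγ : 0 < γ ∧ γ < 2 * δ)
    (hL : ‖L‖ ^ 2 < (1 / γ - 1 / (2 * δ)) * (1 / τ - 1 / (2 * μ)))
    -- the random activation indices
    (ε : ℕ → Ω → Fin (m + 1)) (hε : ∀ k, Measurable (ε k)) (hindep : iIndepFun ε P)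
    -- the iterates
    (x₀ : H) (u₀ : G) (x xbar p : ℕ → Ω → H) (u : ℕ → Ω → G)
    (hiter : ∀ ω, IsPrimalDualIteration A B D C L T τ γ x₀ u₀ (fun k => ε k ω)
      (fun k => x k ω) (fun k => xbar k ω) (fun k => p k ω) (fun k => u k ω))
    -- the two alternative assumptions
    (hcase :
      primalDualSolutions A B D C L ⊆ commonFixedPoints T ×ˢ Set.univ ∨
      ((∃ N : ℕ, 0 < N ∧ ∀ n : ℕ,
          {i : Fin (m + 1) | i ≠ 0} ⊆ ⋃ k ∈ Set.Ico n (n + N), Set.range (ε k)) ∧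
        ∃ ζ : ℝ, 0 < ζ ∧
          ∀ k, ∀ i ∈ Set.range (ε k) \ {0}, ζ ≤ P.real (ε k ⁻¹' {i}))) :
    ∃ z : Ω → H × G, Measurable z ∧
      (∀ ω, z ω ∈ (commonFixedPoints T ×ˢ Set.univ) ∩ primalDualSolutions A B D C L) ∧
      ∀ᵐ ω ∂P, Tendsto (fun k => toWeakSpace ℝ (H × G) (x k ω, u k ω)) atTop
        (𝓝 (toWeakSpace ℝ (H × G) (z ω))) := by
  have hfactor : ∀ k ω ω', (∀ j ≤ k, ε j ω = ε j ω') → x k ω = x k ω' ∧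
      xbar k ω = xbar k ω' ∧ u k ω = u k ω' ∧ p (k + 1) ω = p (k + 1) ω' := fun k ω ω' h =>
    (hiter ω).eq_of_eq_le hA.prop hB.prop hδ hDδ hτ.1 hγ.1 (hiter ω') k h
  have hxm : ∀ k, Measurable (x k) := fun k =>
    (measurable_and_indepFun_of_factorsThrough hε hindep (Finset.range (k + 1))
      fun ω ω' h => (hfactor k ω ω' fun j hj => h j (Finset.mem_range.2 (by omega))).1).1
  have hum : ∀ k, Measurable (u k) := fun k =>
    (measurable_and_indepFun_of_factorsThrough hε hindep (Finset.range (k + 1))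
      fun ω ω' h => (hfactor k ω ω' fun j hj => h j (Finset.mem_range.2 (by omega))).2.2.1).1
  have hweak : ∀ᵐ ω ∂P, ∃ z ∈ (commonFixedPoints T ×ˢ Set.univ) ∩ primalDualSolutions A B D C L,
      WeaklyTendsto atTop (fun k => x k ω) z.1 ∧ WeaklyTendsto atTop (fun k => u k ω) z.2 := by
    rcases hcase with hcase | ⟨⟨N, -, hN⟩, ζ, hζ, hprob⟩
    · exact ae_of_all _ fun ω => exists_weak_limit_of_fixed_cluster_points hA hB hD hδ hDδ hμ hC
        hα hT hZ hτ hγ hL (hiter ω) fun _ z hz _ _ _ => (hcase hz).1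
    · obtain ⟨⟨xs, us⟩, ⟨hxS, -⟩, hs⟩ := id hZ
      obtain ⟨hxA, ds, huB, hds⟩ := mem_primalDualSolutions.1 hs
      obtain ⟨K, hK⟩ := exists_primalDual_bounds hA.prop hB.prop hδ hDδ hμ hC hα hT hτ hγ hL hxS
        hxA huB hds x₀ u₀
      have hKsum : ∀ ω n, ∑ k ∈ Finset.range n, ‖x (k + 1) ω - p (k + 1) ω‖ ^ 2 ≤ K := by
        intro ω n
        obtain ⟨d, hd⟩ := (hiter ω).exists_dual_seq hτ.1 hγ.1
        refine (Finset.sum_le_sum fun k _ => ?_).trans ((hK (hiter ω) hd).1 n)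
        simp only [primalDualResidual]
        have h1 := sq_nonneg ‖u (k + 1) ω - u k ω‖
        have h2 := sq_nonneg ‖xbar k ω - x k ω‖
        have h4 := sq_nonneg ‖C (x k ω) - C xs‖
        have h5 := sq_nonneg ‖d k - ds‖
        linarith
      -- Along the times when `i` can be drawn, whether or not it is drawn on the given path, its
      -- residual at `p` vanishes.
      have hres : ∀ᵐ ω ∂P, ∀ i : Fin m, Tendsto
          ({k | i.succ ∈ Set.range (ε (k + 1))}.indicator
            fun k => ‖T i (p (k + 1) ω) - p (k + 1) ω‖) atTop (𝓝 0) :=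
        ae_all_iff.2 fun i => ae_tendsto_map_sub_self_of_activation P hε hindep (T := T)
          (fun k ω => (hiter ω).x_succ k) (fun k ω ω' h => (hfactor k ω ω' h).2.2.2) hKsum hζ
          i.succ fun k hk => hprob (k + 1) i.succ ⟨hk, Fin.succ_ne_zero i⟩
      filter_upwards [hres] with ω hω
      refine exists_weak_limit_of_fixed_cluster_points hA hB hD hδ hDδ hμ hC
        hα hT hZ hτ hγ hL (hiter ω) fun {F _ K'} hF z hz hpK hpp hpz =>
          Set.mem_iInter.2 fun i => ?_
      have hTi := (hT i).norm_sub_le (hα i)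
      have hwindow : ∀ n, ∃ k ∈ Set.Ico n (n + N),
          k ∈ {k | i.succ ∈ Set.range (ε (k + 1))} := by
        intro n
        -- The window starts at `n + 1` because position `k` of the sequence `p (k + 1)` is paired
        -- with `ε (k + 1)`.
        have hmem := hN (n + 1) (Fin.succ_ne_zero i : i.succ ∈ {j : Fin (m + 1) | j ≠ 0})
        simp only [Set.mem_iUnion] at hmem
        obtain ⟨k, ⟨hk1, hk2⟩, hk⟩ := hmem
        obtain ⟨k, rfl⟩ : ∃ l, k = l + 1 := ⟨k - 1, by omega⟩
        exact ⟨k, ⟨by omega, by omega⟩, hk⟩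
      have hlim := tendsto_map_sub_self_of_window hTi (a := fun k => p (k + 1) ω) hpp hwindow (hω i)
      refine fixed_of_weaklyTendsto hTi hpK hpz ?_
      simpa using (hlim.neg).mono_left hF
  obtain ⟨z, hzm, hzZ, hz⟩ := exists_measurable_weak_limit hZ hxm hum hweak
  refine ⟨z, hzm, hzZ, ?_⟩
  filter_upwards [hz] with ω hω using hω.1.tendsto_toWeakSpace hω.2
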